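/- **Setting.** Let $\Gamma$ be a finitely generated group and let $Q$ be a finite symmetric set of generators, with word length $l$. Let $Z$ be a uniformly recurrent subgroup of $\Gamma$. That is, $Z$ is a non-empty closed subset of the space of subgroups of $\Gamma$ (with the topology of pointwise convergence of characteristic functions), $Z$ is invariant under conjugation, and every conjugation orbit in $Z$ is dense in $Z$. Fix $H\in Z$. Let $S$ be the Schreier graph of $H$: its vertices are the cosets in $\Gamma/H$, and for each vertex $x$ and each $q\in Q$ there is an edge labelled $q$ from $x$ to $qx$. Let $d$ be its path metric and $B_n(x)$ the ball of radius $n$ around $x$, regarded as an induced labelled graph with root $x$. For vertices $x,y$ write $x\sim_n y$ if there is a root- and label-preserving isomorphism $B_n(x)\cong B_n(y)$. **The algebra $C^*_r(Z)$.** A function $K:\Gamma/H\times\Gamma/H\to\mathbb C$ is a *local kernel of width $R$* if $K(x,y)=0$ whenever $d(x,y)>R$, and $K(x,\gamma x)=K(y,\gamma y)$ whenever $x\sim_R y$ and $l(\gamma)\le R$. The local kernels of arbitrary finite width form a $*$-algebra $\mathbb CZ$ with pointwise linear structure, product $(KL)(x,y)=\sum_z K(x,z)L(z,y)$ and involution $K^*(x,y)=\overline{K(y,x)}$.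 It acts faithfully on $\ell^2(\Gamma/H)$ by $(\pi(K)f)(x)=\sum_y K(x,y)f(y)$. Then $C^*_r(Z)$ is the completion of $\mathbb CZ$ in the norm $\|\pi(K)\|$. **The groupoid $\mathcal G$.** Let $E_n=(\Gamma/H)/{\sim_n}$. Let $F_n$ be the finite discrete set consisting of a point $\infty_n$ and of the disjoint union, over $[x]\in E_n$, of the vertex sets of the balls $B_n(x)$; balls around equivalent vertices are identified along root-label isomorphisms. We write $([x],y)\in F_n$ for the point given by $y\in B_n(x)$. The connecting map $F_{n+1}\to F_n$ sends $([x],y)$ to $([x],y)$ if $d(x,y)\le n$ and to $\infty_n$ otherwise, and sends $\infty_{n+1}$ to $\infty_n$. Put $$\mathcal G^{0}=\varprojlim E_n,\qquad \mathcal G=\varprojlim F_n\setminus\{(\infty_n)_n\},$$ with the topologies induced by the projective limits. Each pair $(x,\gamma)$ with $x=([x_n]_n)_n\in\mathcal G^{0}$ and $\gamma\in\Gamma$ represents an arrow, also denoted $(x,\gamma)$: its component in $F_n$ is $([x_n],\gamma x_n)$ for all $n\ge l(\gamma)$. Every arrow is of this form. The groupoid structure is $$r(x,\gamma)=x,\quad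 s(x,\gamma)=\gamma x,\quad (y,\gamma')(\gamma'y,\gamma)=(y,\gamma\gamma'),\quad (x,\gamma)^{-1}=(\gamma x,\gamma^{-1}),$$ where $\gamma x=([\gamma x_{n+l(\gamma)}]_n)_n$. The units are the arrows $(x,e)$. **The algebra $C^*_r(\mathcal G)$.** The space $C_c(\mathcal G)$ of continuous compactly supported functions $\mathcal G\to\mathbb C$ is a $*$-algebra with $(f*g)(a)=\sum_{r(b)=r(a)}f(b)g(b^{-1}a)$ and $f^*(a)=\overline{f(a^{-1})}$. For $x\in\mathcal G^{0}$ let $\mathcal G_x=s^{-1}(x)$, and let $\pi_x$ be the representation of $C_c(\mathcal G)$ on $\ell^2(\mathcal G_x)$ with $\pi_x(f)\delta_g=\sum_{s(g')=r(g)}f(g')\delta_{g'g}$. Then $C^*_r(\mathcal G)$ is the completion of $C_c(\mathcal G)$ in the norm $\|f\|_r=\sup_{x\in\mathcal G^{0}}\|\pi_x(f)\|$. **Theorem 3.3.** There is an injective $*$-homomorphism $\kappa:\mathbb CZ\to C_c(\mathcal G)$, $K\mapsto f_K$, with the following properties. 1. If $K$ is a local kernel of width $N$ and $a\in\mathcal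 G$, then $f_K(a)=K(x,y)$ if the component of $a$ in $F_N$ is $([x],y)$, and $f_K(a)=0$ if this component is $\infty_N$. 2. The image of $\kappa$ is exactly the set of locally constant functions in $C_c(\mathcal G)$. 3. All regular representations give the same norm: $\|\pi_x(f)\|=\|f\|_r$ for all $f\in C_c(\mathcal G)$ and all $x\in\mathcal G^{0}$. Moreover $\|\pi_x(f_K)\|=\|\pi(K)\|$ for all $K\in\mathbb CZ$ and all $x\in\mathcal G^{0}$. 4. There is an isometric $*$-isomorphism $\Phi:C^*_r(Z)\to C^*_r(\mathcal G)$ with $\Phi(K)=f_K$ for all $K\in\mathbb CZ$, and every $*$-homomorphism $C^*_r(Z)\to C^*_r(\mathcal G)$ that sends $K$ to $f_K$ for all $K\in\mathbb CZ$ is equal to $\Phi$. -/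

import Mathlib

namespace ElekURS

noncomputable section

/-- The Hilbert space of square-summable complex functions on the set `X`. -/
abbrev L2 (X : Type*) : Type _ := lp (fun _ : X => ℂ) 2

/-- Bounded operators on `L2 X`. -/
abbrev BL2 (X : Type*) : Type _ := L2 X →L[ℂ] L2 X

/-- The entries of the matrix `M` are bounded by `C`, and every row and every column has at most
`N` non-zero entries. -/
structure IsBanded {X : Type*} (M : X → X → ℂ) (C : ℝ) (N : ℕ) : Prop where
  bound : ∀ x y, ‖M x y‖ ≤ C
  row : ∀ x, {y | M x y ≠ 0}.encard ≤ N
  col : ∀ y, {x | M x y ≠ 0}.encard ≤ N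

namespace IsBanded

variable {X : Type*} {M : X → X → ℂ} {C : ℝ} {N : ℕ}

theorem row_finite (h : IsBanded M C N) (x : X) : {y | M x y ≠ 0}.Finite :=
  Set.finite_of_encard_le_coe (h.row x)

theorem tsum_eq (h : IsBanded M C N) (x : X) (ξ : X → ℂ) :
    ∑' y, M x y * ξ y = ∑ y ∈ (h.row_finite x).toFinset, M x y * ξ y := by
  apply tsum_eq_sum
  intro y hy
  have : M x y = 0 := by simpa using hy
  simp [this]

theorem sum_sq_le (h : IsBanded M C N) (ξ : L2 X) (s : Finset X) :
    ∑ x ∈ s, ‖∑' y, M x y * ξ y‖ ^ 2 ≤ (|C| * N * ‖ξ‖) ^ 2 := by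
  classical
  set S : X → Finset X := fun x => (h.row_finite x).toFinset with hS
  have hSmem : ∀ x y, y ∈ S x ↔ M x y ≠ 0 := by intro x y; simp [hS]
  have hcard : ∀ x, ((S x).card : ℝ) ≤ N := by
    intro x
    have h1 := h.row x
    rw [(h.row_finite x).encard_eq_coe_toFinset_card] at h1
    exact_mod_cast h1
  have hξ : ∀ t : Finset X, ∑ y ∈ t, ‖ξ y‖ ^ 2 ≤ ‖ξ‖ ^ 2 := by
    intro t
    have := lp.sum_rpow_le_norm_rpow (p := 2) (by norm_num) ξ t
    simpa using this
  have h1 : ∀ x, ‖∑' y, M x y * ξ y‖ ^ 2 ≤ |C| ^ 2 * N * ∑ y ∈ S x, ‖ξ y‖ ^ 2 := by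
    intro x
    rw [h.tsum_eq]
    have a1 : ‖∑ y ∈ S x, M x y * ξ y‖ ≤ |C| * ∑ y ∈ S x, ‖ξ y‖ := by
      rw [Finset.mul_sum]
      refine (norm_sum_le _ _).trans (Finset.sum_le_sum fun y _ => ?_)
      rw [norm_mul]
      exact mul_le_mul_of_nonneg_right ((h.bound x y).trans (le_abs_self C)) (norm_nonneg _)
    have a2 : (∑ y ∈ S x, ‖ξ y‖) ^ 2 ≤ (S x).card * ∑ y ∈ S x, ‖ξ y‖ ^ 2 :=
      sq_sum_le_card_mul_sum_sq
    have a3 : 0 ≤ ∑ y ∈ S x, ‖ξ y‖ ^ 2 := Finset.sum_nonneg fun _ _ => by positivity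
    calc ‖∑ y ∈ S x, M x y * ξ y‖ ^ 2 ≤ (|C| * ∑ y ∈ S x, ‖ξ y‖) ^ 2 := by gcongr
      _ = |C| ^ 2 * (∑ y ∈ S x, ‖ξ y‖) ^ 2 := by ring
      _ ≤ |C| ^ 2 * ((S x).card * ∑ y ∈ S x, ‖ξ y‖ ^ 2) := by gcongr
      _ ≤ |C| ^ 2 * (N * ∑ y ∈ S x, ‖ξ y‖ ^ 2) := by gcongr; exact_mod_cast hcard x
      _ = _ := by ring
  have h2 : ∑ x ∈ s, ∑ y ∈ S x, ‖ξ y‖ ^ 2 ≤ N * ‖ξ‖ ^ 2 := by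
    set t := s.biUnion S with ht
    have b1 : ∀ x ∈ s, ∑ y ∈ S x, ‖ξ y‖ ^ 2 = ∑ y ∈ t, if M x y ≠ 0 then ‖ξ y‖ ^ 2 else 0 := by
      intro x hx
      rw [← Finset.sum_filter]
      apply Finset.sum_congr _ fun _ _ => rfl
      ext y
      simp only [Finset.mem_filter, ht, Finset.mem_biUnion, hSmem]
      exact ⟨fun hy => ⟨⟨x, hx, hy⟩, hy⟩, fun hy => hy.2⟩
    rw [Finset.sum_congr rfl b1, Finset.sum_comm]
    have b2 : ∀ y ∈ t, (∑ x ∈ s, if M x y ≠ 0 then ‖ξ y‖ ^ 2 else 0) ≤ N * ‖ξ y‖ ^ 2 := by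
      intro y _
      rw [← Finset.sum_filter, Finset.sum_const, nsmul_eq_mul]
      have : (((s.filter fun x => M x y ≠ 0).card : ℕ) : ℕ∞) ≤ N := by
        refine le_trans ?_ (h.col y)
        rw [← Set.encard_coe_eq_coe_finsetCard]
        apply Set.encard_le_encard
        intro x hx
        simpa using (Finset.mem_filter.mp (Finset.mem_coe.mp hx)).2
      have : ((s.filter fun x => M x y ≠ 0).card : ℝ) ≤ N := by exact_mod_cast this
      gcongr
    calc _ ≤ ∑ y ∈ t, (N : ℝ) * ‖ξ y‖ ^ 2 := Finset.sum_le_sum b2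
      _ = N * ∑ y ∈ t, ‖ξ y‖ ^ 2 := by rw [Finset.mul_sum]
      _ ≤ _ := by gcongr; exact hξ t
  calc ∑ x ∈ s, ‖∑' y, M x y * ξ y‖ ^ 2
      ≤ ∑ x ∈ s, |C| ^ 2 * N * ∑ y ∈ S x, ‖ξ y‖ ^ 2 := Finset.sum_le_sum fun x _ => h1 x
    _ = |C| ^ 2 * N * ∑ x ∈ s, ∑ y ∈ S x, ‖ξ y‖ ^ 2 := by rw [Finset.mul_sum]
    _ ≤ |C| ^ 2 * N * (N * ‖ξ‖ ^ 2) := by gcongr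
    _ = _ := by ring

theorem memlp (h : IsBanded M C N) (ξ : L2 X) : Memℓp (fun x => ∑' y, M x y * ξ y) 2 := by
  apply memℓp_gen' (C := (|C| * N * ‖ξ‖) ^ 2)
  intro s
  simpa using h.sum_sq_le ξ s

end IsBanded

/-- The bounded operator on `L2 X` with matrix `M`, for a matrix with bounded entries and a bounded
number of non-zero entries in every row and column: `(M ξ)(x) = ∑ y, M x y * ξ y`. -/
def matrixOp {X : Type*} (M : X → X → ℂ) (h : ∃ C N, IsBanded M C N) : BL2 X :=
  LinearMap.mkContinuousOfExistsBound
    { toFun := fun ξ => ⟨fun x => ∑' y, M x y * ξ y, h.choose_spec.choose_spec.memlp ξ⟩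
      map_add' := fun ξ η => by
        ext x
        have hb := h.choose_spec.choose_spec
        simp only [lp.coeFn_add, Pi.add_apply]
        have e := fun ζ => hb.tsum_eq x ζ
        rw [e ξ, e η, ← Finset.sum_add_distrib]
        refine Eq.trans ?_ (Finset.sum_congr rfl fun y _ => mul_add _ _ _)
        exact e fun y => ξ y + η y
      map_smul' := fun c ξ => by
        ext x
        simp only [lp.coeFn_smul, Pi.smul_apply, smul_eq_mul, RingHom.id_apply]
        rw [← tsum_mul_left]
        exact tsum_congr fun y => by ring }
    ⟨|h.choose| * h.choose_spec.choose, fun ξ =>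
      lp.norm_le_of_forall_sum_le (by norm_num) (by positivity) fun s => by
        simpa using h.choose_spec.choose_spec.sum_sq_le ξ s⟩

section matrixOp

variable {X : Type*} {M M₁ M₂ : X → X → ℂ}

theorem matrixOp_apply (h : ∃ C N, IsBanded M C N) (ξ : L2 X) (x : X) :
    matrixOp M h ξ x = ∑' y, M x y * ξ y := rfl

theorem norm_matrixOp_le (h : ∃ C N, IsBanded M C N) {C : ℝ} {N : ℕ} (hb : IsBanded M C N) :
    ‖matrixOp M h‖ ≤ |C| * N := by
  refine ContinuousLinearMap.opNorm_le_bound _ (by positivity) fun ξ => ?_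
  refine lp.norm_le_of_forall_sum_le (by norm_num) (by positivity) fun s => ?_
  simpa [matrixOp_apply] using hb.sum_sq_le ξ s

/-- The standard basis vector at `y`. -/
def basisVec (y : X) : L2 X :=
  haveI := Classical.decEq X
  lp.single 2 y (1 : ℂ)

theorem basisVec_self (y : X) : basisVec y y = 1 := by
  simp [basisVec]

theorem basisVec_ne {x y : X} (h : x ≠ y) : basisVec y x = 0 := by
  simp [basisVec, h]

theorem matrixOp_basisVec (h : ∃ C N, IsBanded M C N) (x y : X) :
    matrixOp M h (basisVec y) x = M x y := by
  rw [matrixOp_apply, tsum_eq_single y]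
  · rw [basisVec_self, mul_one]
  · intro z hz
    rw [basisVec_ne hz, mul_zero]

theorem op_ext {S T : BL2 X} (h : ∀ x y, S (basisVec y) x = T (basisVec y) x) : S = T := by
  classical
  ext1 ξ
  have hs := lp.hasSum_single (p := 2) (by norm_num) ξ
  have key : ∀ y, S (lp.single 2 y (ξ y)) = T (lp.single 2 y (ξ y)) := by
    intro y
    have : (lp.single 2 y (ξ y) : L2 X) = ξ y • basisVec y := by
      ext x
      by_cases hx : x = y
      · subst hx; simp [basisVec_self]
      · simp [basisVec_ne hx, hx]
    rw [this, map_smul, map_smul]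
    congr 1
    ext x
    exact h x y
  have h1 := hs.mapL S
  have h2 := hs.mapL T
  simp only [key] at h1
  exact h1.unique h2

theorem inner_basisVec (x : X) (ξ : L2 X) : inner ℂ (basisVec x) ξ = ξ x := by
  rw [lp.inner_eq_tsum, tsum_eq_single x]
  · simp [basisVec_self]
  · intro y hy
    simp [basisVec_ne hy]

theorem matrixOp_injective (h₁ : ∃ C N, IsBanded M₁ C N) (h₂ : ∃ C N, IsBanded M₂ C N)
    (h : matrixOp M₁ h₁ = matrixOp M₂ h₂) : M₁ = M₂ := by
  funext x y
  rw [← matrixOp_basisVec h₁, ← matrixOp_basisVec h₂, h]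

theorem matrixOp_mul (h : ∃ C N, IsBanded M C N) (h₁ : ∃ C N, IsBanded M₁ C N)
    (h₂ : ∃ C N, IsBanded M₂ C N) (e : ∀ x y, M x y = ∑' z, M₁ x z * M₂ z y) :
    matrixOp M h = matrixOp M₁ h₁ * matrixOp M₂ h₂ := by
  refine op_ext fun x y => ?_
  rw [matrixOp_basisVec, e]
  change _ = matrixOp M₁ h₁ (matrixOp M₂ h₂ (basisVec y)) x
  rw [matrixOp_apply]
  exact tsum_congr fun z => by rw [matrixOp_basisVec]

theorem matrixOp_star (h : ∃ C N, IsBanded M C N) (h₁ : ∃ C N, IsBanded M₁ C N)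
    (e : ∀ x y, M x y = star (M₁ y x)) :
    matrixOp M h = star (matrixOp M₁ h₁) := by
  refine op_ext fun x y => ?_
  rw [matrixOp_basisVec, e, ContinuousLinearMap.star_eq_adjoint, ← inner_basisVec x,
    ContinuousLinearMap.adjoint_inner_right, ← inner_conj_symm, inner_basisVec, matrixOp_basisVec]
  rfl

theorem matrixOp_add (h : ∃ C N, IsBanded M C N) (h₁ : ∃ C N, IsBanded M₁ C N)
    (h₂ : ∃ C N, IsBanded M₂ C N) (e : ∀ x y, M x y = M₁ x y + M₂ x y) :
    matrixOp M h = matrixOp M₁ h₁ + matrixOp M₂ h₂ := by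
  refine op_ext fun x y => ?_
  simp [matrixOp_basisVec, e]

theorem matrixOp_smul (c : ℂ) (h : ∃ C N, IsBanded M C N) (h₁ : ∃ C N, IsBanded M₁ C N)
    (e : ∀ x y, M x y = c * M₁ x y) :
    matrixOp M h = c • matrixOp M₁ h₁ := by
  refine op_ext fun x y => ?_
  simp [matrixOp_basisVec, e]

end matrixOp

/-- A finite symmetric system of generators of the group `Γ`. -/
structure SymmGen (Γ : Type*) [Group Γ] where
  carrier : Finset Γ
  inv_mem : ∀ s ∈ carrier, s⁻¹ ∈ carrier
  closure_eq_top : Subgroup.closure (carrier : Set Γ) = ⊤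

section Combinatorics

variable {Γ : Type*} [Group Γ] (Q : SymmGen Γ)

/-- The elements of `Γ` that are products of at most `n` generators. -/
def words (n : ℕ) : Set Γ :=
  {γ | ∃ w : List Γ, w.length ≤ n ∧ (∀ s ∈ w, s ∈ Q.carrier) ∧ w.prod = γ}

/-- The word length of `γ` with respect to `Q`. -/
def wordLength (γ : Γ) : ℕ := sInf {n | γ ∈ words Q n}

section words

variable {Q}

theorem one_mem_words (n : ℕ) : (1 : Γ) ∈ words Q n := ⟨[], by simp⟩

theorem words_mono {m n : ℕ} (h : m ≤ n) : words Q m ⊆ words Q n := by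
  rintro _ ⟨w, h1, h2, rfl⟩
  exact ⟨w, h1.trans h, h2, rfl⟩

theorem mul_mem_words {m n : ℕ} {γ δ : Γ} (h : γ ∈ words Q m) (h' : δ ∈ words Q n) :
    γ * δ ∈ words Q (m + n) := by
  obtain ⟨w, h1, h2, rfl⟩ := h
  obtain ⟨v, g1, g2, rfl⟩ := h'
  refine ⟨w ++ v, by simp; omega, ?_, by simp⟩
  intro s hs
  rcases List.mem_append.mp hs with hs | hs
  exacts [h2 s hs, g2 s hs]

theorem inv_mem_words {n : ℕ} {γ : Γ} (h : γ ∈ words Q n) : γ⁻¹ ∈ words Q n := by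
  obtain ⟨w, h1, h2, rfl⟩ := h
  refine ⟨(w.map fun x => x⁻¹).reverse, by simpa using h1, ?_, by rw [List.prod_inv_reverse]⟩
  intro s hs
  simp only [List.mem_reverse, List.mem_map] at hs
  obtain ⟨t, ht, rfl⟩ := hs
  exact Q.inv_mem t (h2 t ht)

theorem mem_words_zero {γ : Γ} : γ ∈ words Q 0 ↔ γ = 1 := by
  constructor
  · rintro ⟨w, h1, h2, rfl⟩
    simp only [nonpos_iff_eq_zero, List.length_eq_zero_iff] at h1
    simp [h1]
  · rintro rfl
    exact one_mem_words 0

theorem mem_words_succ {n : ℕ} {γ : Γ} :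
    γ ∈ words Q (n + 1) ↔ γ ∈ words Q n ∨ ∃ s ∈ Q.carrier, ∃ δ ∈ words Q n, γ = s * δ := by
  constructor
  · rintro ⟨w, h1, h2, rfl⟩
    cases w with
    | nil => exact Or.inl (one_mem_words n)
    | cons s w =>
      refine Or.inr ⟨s, h2 s (by simp), w.prod, ⟨w, ?_, fun t ht => h2 t (by simp [ht]), rfl⟩,
        by simp⟩
      simpa using h1
  · rintro (h | ⟨s, hs, δ, ⟨w, h1, h2, rfl⟩, rfl⟩)
    · exact words_mono (Nat.le_succ n) h
    · refine ⟨s :: w, by simpa using h1, ?_, by simp⟩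
      intro t ht
      rcases List.mem_cons.mp ht with rfl | ht
      exacts [hs, h2 t ht]

variable (Q) in
theorem words_finite (n : ℕ) : (words Q n).Finite := by
  induction n with
  | zero => exact (Set.finite_singleton (1 : Γ)).subset fun γ h => mem_words_zero.mp h
  | succ n ih =>
    refine (ih.union (Set.Finite.image2 (fun s δ => s * δ) Q.carrier.finite_toSet ih)).subset ?_
    intro γ h
    rcases mem_words_succ.mp h with h | ⟨s, hs, δ, hδ, rfl⟩
    exacts [Or.inl h, Or.inr ⟨s, hs, δ, hδ, rfl⟩]

variable (Q) in
theorem exists_mem_words (γ : Γ) : ∃ n, γ ∈ words Q n := by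
  have h : γ ∈ Subgroup.closure (Q.carrier : Set Γ) := by rw [Q.closure_eq_top]; trivial
  induction h using Subgroup.closure_induction with
  | mem x hx => exact ⟨1, [x], by simpa using hx⟩
  | one => exact ⟨0, one_mem_words 0⟩
  | mul x y _ _ hx hy =>
    obtain ⟨m, hm⟩ := hx
    obtain ⟨n, hn⟩ := hy
    exact ⟨m + n, mul_mem_words hm hn⟩
  | inv x _ hx =>
    obtain ⟨m, hm⟩ := hx
    exact ⟨m, inv_mem_words hm⟩

variable (Q) in
theorem mem_words_wordLength (γ : Γ) : γ ∈ words Q (wordLength Q γ) :=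
  Nat.sInf_mem (s := {n | γ ∈ words Q n}) (exists_mem_words Q γ)

theorem mem_words_of_wordLength_le {γ : Γ} {n : ℕ} (h : wordLength Q γ ≤ n) : γ ∈ words Q n :=
  words_mono h (mem_words_wordLength Q γ)

end words

variable {H : Subgroup Γ}

/-- The edges of the Schreier graph of `H`: there is an edge labelled `s` from `u` to `v`
if `s` is one of the generators and `v = s u`. The vertices are the cosets `γH`,
the root is the coset `H`. -/
def schreierEdge (s : Γ) (u v : Γ ⧸ H) : Prop := s ∈ Q.carrier ∧ s • u = v

/-- The vertices of the Schreier graph at distance at most `n` from `x`: the end points of the paths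
of length at most `n` that start at `x`. -/
def ball (n : ℕ) (x : Γ ⧸ H) : Set (Γ ⧸ H) := {y | ∃ γ ∈ words Q n, γ • x = y}

/-- `θ` restricts to a root-label isomorphism from the `n`-ball around `x` to the `n`-ball
around `y`, where balls are induced subgraphs of the Schreier graph. -/
structure IsBallIso (n : ℕ) (x y : Γ ⧸ H) (θ : Γ ⧸ H → Γ ⧸ H) : Prop where
  bijOn : Set.BijOn θ (ball Q n x) (ball Q n y)
  root : θ x = y
  edge : ∀ s, ∀ u ∈ ball Q n x, ∀ v ∈ ball Q n x,
    schreierEdge Q s u v ↔ schreierEdge Q s (θ u) (θ v)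

variable {Q}

theorem self_mem_ball (n : ℕ) (x : Γ ⧸ H) : x ∈ ball Q n x :=
  ⟨1, one_mem_words n, one_smul _ _⟩

theorem ball_mono {m n : ℕ} (h : m ≤ n) (x : Γ ⧸ H) : ball Q m x ⊆ ball Q n x := by
  rintro _ ⟨γ, hγ, rfl⟩
  exact ⟨γ, words_mono h hγ, rfl⟩

theorem smul_mem_ball {n : ℕ} {γ : Γ} (h : γ ∈ words Q n) (x : Γ ⧸ H) : γ • x ∈ ball Q n x :=
  ⟨γ, h, rfl⟩

theorem ball_smul_subset {n k : ℕ} {γ : Γ} (h : γ ∈ words Q k) (x : Γ ⧸ H) :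
    ball Q n (γ • x) ⊆ ball Q (n + k) x := by
  rintro _ ⟨δ, hδ, rfl⟩
  exact ⟨δ * γ, mul_mem_words hδ h, mul_smul _ _ _⟩

theorem ball_finite (n : ℕ) (x : Γ ⧸ H) : (ball Q n x).Finite :=
  ((words_finite Q n).image fun γ => γ • x).subset fun _ ⟨γ, hγ, e⟩ => ⟨γ, hγ, e⟩

theorem mem_ball_comm {n : ℕ} {x y : Γ ⧸ H} : y ∈ ball Q n x ↔ x ∈ ball Q n y := by
  constructor <;>
  · rintro ⟨γ, hγ, rfl⟩
    exact ⟨γ⁻¹, inv_mem_words hγ, inv_smul_smul _ _⟩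

theorem mem_ball_trans {m n : ℕ} {x y z : Γ ⧸ H} (h : y ∈ ball Q m x) (h' : z ∈ ball Q n y) :
    z ∈ ball Q (m + n) x := by
  obtain ⟨γ, hγ, rfl⟩ := h
  have := ball_smul_subset hγ x h'
  rwa [add_comm] at this

namespace IsBallIso

variable {n m k : ℕ} {x y z : Γ ⧸ H} {θ θ' : Γ ⧸ H → Γ ⧸ H}

theorem map_smul (h : IsBallIso Q n x y θ) {γ : Γ} (hγ : γ ∈ words Q n) :
    θ (γ • x) = γ • y := by
  suffices ∀ m ≤ n, ∀ γ ∈ words Q m, θ (γ • x) = γ • y from this n le_rfl γ hγ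
  intro m
  induction m with
  | zero =>
    intro _ γ hγ
    rw [mem_words_zero.mp hγ, one_smul, one_smul, h.root]
  | succ m ih =>
    intro hm γ hγ
    rcases mem_words_succ.mp hγ with hγ' | ⟨s, hs, δ, hδ, rfl⟩
    · exact ih (by omega) γ hγ'
    · have := (h.edge s (δ • x) (smul_mem_ball (words_mono (by omega) hδ) x) ((s * δ) • x)
        (smul_mem_ball (words_mono hm hγ) x)).mp ⟨hs, (mul_smul _ _ _).symm⟩
      rw [← this.2, ih (by omega) δ hδ, mul_smul]

protected theorem refl (n : ℕ) (x : Γ ⧸ H) : IsBallIso Q n x x id :=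
  ⟨Set.bijOn_id _, rfl, fun _ _ _ _ _ => Iff.rfl⟩

theorem comp (h : IsBallIso Q n x y θ) (h' : IsBallIso Q n y z θ') :
    IsBallIso Q n x z (θ' ∘ θ) where
  bijOn := h'.bijOn.comp h.bijOn
  root := by simp [h.root, h'.root]
  edge s u hu v hv := (h.edge s u hu v hv).trans
    (h'.edge s _ (h.bijOn.mapsTo hu) _ (h.bijOn.mapsTo hv))

theorem exists_symm (h : IsBallIso Q n x y θ) :
    ∃ θ', IsBallIso Q n y x θ' ∧ ∀ u ∈ ball Q n x, θ' (θ u) = u := by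
  classical
  have : Nonempty (Γ ⧸ H) := ⟨x⟩
  have hinv := h.bijOn.invOn_invFunOn
  have hmaps := h.bijOn.surjOn.mapsTo_invFunOn
  refine ⟨Function.invFunOn θ (ball Q n x), ⟨⟨hmaps, ?_, ?_⟩, ?_, ?_⟩, hinv.1⟩
  · exact hinv.2.injOn
  · exact hinv.1.surjOn h.bijOn.mapsTo
  · rw [← h.root]; exact hinv.1 (self_mem_ball n x)
  · intro s u hu v hv
    rw [h.edge s _ (hmaps hu) _ (hmaps hv), hinv.2 hu, hinv.2 hv]

theorem image_ball (h : IsBallIso Q n x y θ) {γ : Γ} (hγ : γ ∈ words Q k) (hm : m + k ≤ n) :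
    Set.BijOn θ (ball Q m (γ • x)) (ball Q m (γ • y)) := by
  have hsub : ball Q m (γ • x) ⊆ ball Q n x :=
    (ball_smul_subset hγ x).trans (ball_mono hm x)
  refine ⟨?_, h.bijOn.injOn.mono hsub, ?_⟩
  · rintro _ ⟨δ, hδ, rfl⟩
    refine ⟨δ, hδ, ?_⟩
    rw [← mul_smul, ← mul_smul, h.map_smul (words_mono hm (mul_mem_words hδ hγ))]
  · rintro _ ⟨δ, hδ, rfl⟩
    refine ⟨δ • γ • x, ⟨δ, hδ, rfl⟩, ?_⟩
    rw [← mul_smul, ← mul_smul, h.map_smul (words_mono hm (mul_mem_words hδ hγ))]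

theorem restrict_smul (h : IsBallIso Q n x y θ) {γ : Γ} (hγ : γ ∈ words Q k) (hm : m + k ≤ n) :
    IsBallIso Q m (γ • x) (γ • y) θ where
  bijOn := h.image_ball hγ hm
  root := h.map_smul (words_mono (by omega) hγ)
  edge s u hu v hv := by
    have hsub : ball Q m (γ • x) ⊆ ball Q n x :=
      (ball_smul_subset hγ x).trans (ball_mono hm x)
    exact h.edge s u (hsub hu) v (hsub hv)

theorem restrict (h : IsBallIso Q n x y θ) (hm : m ≤ n) : IsBallIso Q m x y θ := by
  simpa using h.restrict_smul (one_mem_words (Q := Q) 0) (m := m) (by omega)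

theorem mem_ball_iff (h : IsBallIso Q n x y θ) (hm : m ≤ n) {u : Γ ⧸ H} (hu : u ∈ ball Q n x) :
    θ u ∈ ball Q m y ↔ u ∈ ball Q m x := by
  refine ⟨fun hy => ?_, fun hx => (h.restrict hm).bijOn.mapsTo hx⟩
  obtain ⟨v, hv, e⟩ := (h.restrict hm).bijOn.surjOn hy
  rwa [← h.bijOn.injOn (ball_mono hm x hv) hu e]

theorem smul_eq_iff (h : IsBallIso Q n x y θ) {γ δ : Γ} (hγ : γ ∈ words Q n) (hδ : δ ∈ words Q n) :
    γ • x = δ • x ↔ γ • y = δ • y := by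
  rw [← h.map_smul hγ, ← h.map_smul hδ]
  exact (h.bijOn.injOn.eq_iff (smul_mem_ball hγ x) (smul_mem_ball hδ x)).symm

end IsBallIso

variable (Q)

/-- `BallEquiv Q n x y`: the `n`-balls around `x` and `y` are root-label isomorphic. -/
def BallEquiv (n : ℕ) (x y : Γ ⧸ H) : Prop := ∃ θ, IsBallIso Q n x y θ

/-- `K` is a local kernel of width `R`. -/
structure IsLocalKernel (R : ℕ) (K : Γ ⧸ H → Γ ⧸ H → ℂ) : Prop where
  width : ∀ x y, y ∉ ball Q R x → K x y = 0
  local_eq : ∀ x y, BallEquiv Q R x y → ∀ γ ∈ words Q R, K x (γ • x) = K y (γ • y)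

variable {Q}

theorem BallEquiv.refl (n : ℕ) (x : Γ ⧸ H) : BallEquiv Q n x x := ⟨id, .refl n x⟩

theorem BallEquiv.symm {n : ℕ} {x y : Γ ⧸ H} (h : BallEquiv Q n x y) : BallEquiv Q n y x :=
  h.elim fun _ hθ => hθ.exists_symm.elim fun θ' h' => ⟨θ', h'.1⟩

theorem BallEquiv.trans {n : ℕ} {x y z : Γ ⧸ H} (h : BallEquiv Q n x y) (h' : BallEquiv Q n y z) :
    BallEquiv Q n x z :=
  h.elim fun _ hθ => h'.elim fun _ hθ' => ⟨_, hθ.comp hθ'⟩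

theorem BallEquiv.restrict {m n : ℕ} {x y : Γ ⧸ H} (h : BallEquiv Q n x y) (hm : m ≤ n) :
    BallEquiv Q m x y :=
  h.elim fun θ hθ => ⟨θ, hθ.restrict hm⟩

theorem BallEquiv.of_smul_eq_iff {n : ℕ} {x y : Γ ⧸ H}
    (h : ∀ γ ∈ words Q (n + 1), ∀ δ ∈ words Q (n + 1), γ • x = δ • x ↔ γ • y = δ • y) :
    BallEquiv Q n x y := by
  classical
  have hle : words Q n ⊆ words Q (n + 1) := words_mono (Nat.le_succ n)
  set θ : Γ ⧸ H → Γ ⧸ H := fun u => if hu : u ∈ ball Q n x then hu.choose • y else u with hθ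
  have key : ∀ γ ∈ words Q n, θ (γ • x) = γ • y := by
    intro γ hγ
    have hu := smul_mem_ball hγ x
    have e : θ (γ • x) = hu.choose • y := dif_pos hu
    rw [e]
    exact (h _ (hle hu.choose_spec.1) _ (hle hγ)).mp hu.choose_spec.2
  refine ⟨θ, ⟨?_, ?_, ?_⟩, ?_, ?_⟩
  · rintro _ ⟨γ, hγ, rfl⟩
    rw [key γ hγ]
    exact smul_mem_ball hγ y
  · rintro _ ⟨γ, hγ, rfl⟩ _ ⟨δ, hδ, rfl⟩ e
    rw [key γ hγ, key δ hδ] at e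
    exact (h _ (hle hγ) _ (hle hδ)).mpr e
  · rintro _ ⟨γ, hγ, rfl⟩
    exact ⟨γ • x, smul_mem_ball hγ x, key γ hγ⟩
  · simpa using key 1 (one_mem_words n)
  · rintro s _ ⟨γ, hγ, rfl⟩ _ ⟨δ, hδ, rfl⟩
    rw [key γ hγ, key δ hδ]
    refine and_congr_right fun hs => ?_
    rw [← mul_smul, ← mul_smul]
    exact h _ (mem_words_succ.mpr (Or.inr ⟨s, hs, γ, hγ, rfl⟩)) _ (hle hδ)

variable (Q H) in
/-- The equivalence relation on the vertices of the Schreier graph given by root-label isomorphism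
of the `n`-balls. -/
def vertexSetoid (n : ℕ) : Setoid (Γ ⧸ H) where
  r := BallEquiv Q n
  iseqv := ⟨BallEquiv.refl n, BallEquiv.symm, BallEquiv.trans⟩

variable (Q H) in
/-- The finite set of root-label isomorphism classes of `n`-balls in the Schreier graph. -/
def BallClass (n : ℕ) : Type _ := Quotient (vertexSetoid Q H n)

variable (Q) in
/-- The class of the `n`-ball around a vertex. -/
def ballClass (n : ℕ) (x : Γ ⧸ H) : BallClass Q H n := Quotient.mk (vertexSetoid Q H n) x

theorem ballClass_eq {n : ℕ} {x y : Γ ⧸ H} :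
    ballClass Q n x = ballClass Q n y ↔ BallEquiv Q n x y :=
  Quotient.eq (r := vertexSetoid Q H n)

theorem ballClass_surjective {n : ℕ} (c : BallClass Q H n) : ∃ x, ballClass Q n x = c :=
  Quotient.exists_rep c

instance (n : ℕ) : Finite (BallClass Q H n) := by
  have : Finite (words Q (n + 1)) := (words_finite Q (n + 1)).to_subtype
  refine Finite.of_injective (β := Set (words Q (n + 1) × words Q (n + 1)))
    (fun c => {p | (p.1 : Γ) • c.out = (p.2 : Γ) • c.out}) fun c d h => ?_
  rw [← Quotient.out_eq c, ← Quotient.out_eq d]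
  refine Quotient.sound (BallEquiv.of_smul_eq_iff fun γ hγ δ hδ => ?_)
  have := Set.ext_iff.mp h (⟨γ, hγ⟩, ⟨δ, hδ⟩)
  exact this

namespace IsLocalKernel

variable {R R₁ R₂ : ℕ} {K L : Γ ⧸ H → Γ ⧸ H → ℂ}

theorem iso_eq (h : IsLocalKernel Q R K) {n : ℕ} (hn : R ≤ n) {x y : Γ ⧸ H} {θ : Γ ⧸ H → Γ ⧸ H}
    (hθ : IsBallIso Q n x y θ) {u : Γ ⧸ H} (hu : u ∈ ball Q n x) : K x u = K y (θ u) := by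
  by_cases hu' : u ∈ ball Q R x
  · obtain ⟨γ, hγ, rfl⟩ := hu'
    rw [hθ.map_smul (words_mono hn hγ)]
    exact h.local_eq x y ⟨θ, hθ.restrict hn⟩ γ hγ
  · rw [h.width _ _ hu', h.width]
    rwa [hθ.mem_ball_iff hn hu]

theorem mono (h : IsLocalKernel Q R K) {n : ℕ} (hn : R ≤ n) : IsLocalKernel Q n K where
  width x y hy := h.width x y fun hy' => hy (ball_mono hn x hy')
  local_eq x y hxy γ hγ := by
    obtain ⟨θ, hθ⟩ := hxy
    rw [h.iso_eq hn hθ (smul_mem_ball hγ x), hθ.map_smul hγ]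

theorem add (h : IsLocalKernel Q R K) (h' : IsLocalKernel Q R L) :
    IsLocalKernel Q R fun x y => K x y + L x y where
  width x y hy := by simp [h.width x y hy, h'.width x y hy]
  local_eq x y hxy γ hγ := by rw [h.local_eq x y hxy γ hγ, h'.local_eq x y hxy γ hγ]

theorem smul (c : ℂ) (h : IsLocalKernel Q R K) : IsLocalKernel Q R fun x y => c * K x y where
  width x y hy := by simp [h.width x y hy]
  local_eq x y hxy γ hγ := by rw [h.local_eq x y hxy γ hγ]

theorem star (h : IsLocalKernel Q R K) :
    IsLocalKernel Q (R + R) fun x y => Star.star (K y x) where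
  width x y hy := by
    rw [h.width, star_zero]
    exact fun hx => hy (ball_mono (by omega) x (mem_ball_comm.mp hx))
  local_eq x y hxy γ hγ := by
    obtain ⟨θ, hθ⟩ := hxy
    by_cases hx : γ • x ∈ ball Q R x
    · obtain ⟨δ, hδ, e⟩ := hx
      have hx' : δ • y = γ • y :=
        (hθ.smul_eq_iff (words_mono (by omega) hδ) hγ).mp e
      rw [← e, ← hx']
      have := h.local_eq (δ • x) (δ • y) ⟨θ, hθ.restrict_smul hδ le_rfl⟩ δ⁻¹ (inv_mem_words hδ)
      rw [inv_smul_smul, inv_smul_smul] at this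
      rw [this]
    · have hy : γ • y ∉ ball Q R y := by
        rwa [← hθ.map_smul hγ, hθ.mem_ball_iff (by omega) (smul_mem_ball hγ x)]
      rw [h.width _ _ fun h => hx (mem_ball_comm.mp h),
        h.width _ _ fun h => hy (mem_ball_comm.mp h)]

theorem tsum_eq (h : IsLocalKernel Q R K) {n : ℕ} (hn : R ≤ n) (x : Γ ⧸ H) (f : Γ ⧸ H → ℂ) :
    ∑' z, K x z * f z = ∑ z ∈ (ball_finite (Q := Q) n x).toFinset, K x z * f z := by
  apply tsum_eq_sum
  intro z hz
  rw [h.width x z, zero_mul]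
  exact fun hz' => hz (by simpa using ball_mono hn x hz')

theorem mul (h : IsLocalKernel Q R K) (h' : IsLocalKernel Q R L) :
    IsLocalKernel Q (R + R) fun x y => ∑' z, K x z * L z y where
  width x y hy := by
    rw [h.tsum_eq le_rfl]
    refine Finset.sum_eq_zero fun z hz => ?_
    rw [h'.width z y, mul_zero]
    exact fun hy' => hy (mem_ball_trans (by simpa using hz) hy')
  local_eq x y hxy γ hγ := by
    obtain ⟨θ, hθ⟩ := hxy
    have hb := (hθ.restrict (m := R) (by omega)).bijOn
    rw [h.tsum_eq le_rfl, h.tsum_eq le_rfl]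
    refine Finset.sum_nbij θ ?_ ?_ ?_ ?_
    · intro z hz
      simpa using hb.mapsTo (by simpa using hz)
    · simpa using hb.injOn
    · simpa using hb.surjOn
    · intro z hz
      have hz : z ∈ ball Q R x := by simpa using hz
      rw [h.iso_eq le_rfl (hθ.restrict (by omega)) hz]
      congr 1
      obtain ⟨δ, hδ, rfl⟩ := hz
      have hθ' := hθ.restrict_smul hδ (m := R) le_rfl
      rw [hθ.map_smul (words_mono (by omega) hδ), ← hθ.map_smul hγ]
      by_cases hu : γ • x ∈ ball Q R (δ • x)
      · exact h'.iso_eq le_rfl hθ' hu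
      · rw [h'.width _ _ hu, h'.width]
        intro hu'
        obtain ⟨v, hv, e⟩ := hθ'.bijOn.surjOn hu'
        have hv' : v ∈ ball Q (R + R) x := ball_smul_subset hδ x hv
        rw [hθ.bijOn.injOn hv' (smul_mem_ball hγ x) e] at hv
        exact hu hv

theorem isBanded (h : IsLocalKernel Q R K) : ∃ C N, IsBanded K C N := by
  have hfin : (Set.range fun p : (Γ ⧸ H) × (Γ ⧸ H) => K p.1 p.2).Finite := by
    have : Finite (words Q R) := (words_finite Q R).to_subtype
    refine ((Set.finite_range fun p : BallClass Q H R × words Q R =>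
      K p.1.out ((p.2 : Γ) • p.1.out)).union (Set.finite_singleton 0)).subset ?_
    rintro _ ⟨⟨x, y⟩, rfl⟩
    by_cases hy : y ∈ ball Q R x
    · obtain ⟨γ, hγ, rfl⟩ := hy
      refine Or.inl ⟨(ballClass Q R x, ⟨γ, hγ⟩), ?_⟩
      exact h.local_eq _ _ (Quotient.mk_out (s := vertexSetoid Q H R) x) γ hγ
    · exact Or.inr (h.width x y hy)
  obtain ⟨C, hC⟩ := hfin.isBounded.exists_norm_le
  have hball : ∀ x : Γ ⧸ H, (ball Q R x).encard ≤ (words Q R).ncard := by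
    intro x
    have : ball Q R x = (fun γ : Γ => γ • x) '' words Q R := by
      ext y; exact Iff.rfl
    rw [this, (words_finite Q R).cast_ncard_eq]
    exact Set.encard_image_le _ _
  refine ⟨C, (words Q R).ncard, fun x y => hC _ ⟨(x, y), rfl⟩, fun x => ?_, fun y => ?_⟩
  · refine le_trans (Set.encard_le_encard fun y hy => ?_) (hball x)
    by_contra hy'
    exact hy (h.width x y hy')
  · refine le_trans (Set.encard_le_encard fun x hx => ?_) (hball y)
    by_contra hx'
    exact hx (h.width x y fun hy => hx' (mem_ball_comm.mp hy))

end IsLocalKernel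

variable (Q H)

/-- The space of all local kernels of finite width on the Schreier graph of `H`. -/
def localKernels : Submodule ℂ (Γ ⧸ H → Γ ⧸ H → ℂ) where
  carrier := {K | ∃ R, IsLocalKernel Q R K}
  add_mem' := by
    rintro K L ⟨R, hK⟩ ⟨S, hL⟩
    exact ⟨max R S, (hK.mono (le_max_left R S)).add (hL.mono (le_max_right R S))⟩
  zero_mem' := ⟨0, fun _ _ _ => rfl, fun _ _ _ _ _ => rfl⟩
  smul_mem' := by
    rintro c K ⟨R, hK⟩
    exact ⟨R, hK.smul c⟩

/-- The local kernel algebra: local kernels with pointwise linear structure, the product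
`(K * L)(x, y) = ∑ z, K(x, z) L(z, y)` and the involution `K^*(x, y) = conj (K(y, x))`. -/
def KernelAlg : Type _ := localKernels Q H

namespace KernelAlg

instance : AddCommGroup (KernelAlg Q H) := inferInstanceAs (AddCommGroup (localKernels Q H))

instance : Module ℂ (KernelAlg Q H) := inferInstanceAs (Module ℂ (localKernels Q H))

variable {Q H}

/-- The value `K(x, y)` of a local kernel. -/
def val (K : KernelAlg Q H) : Γ ⧸ H → Γ ⧸ H → ℂ := Subtype.val (p := (· ∈ localKernels Q H)) K

theorem exists_isLocalKernel (K : KernelAlg Q H) : ∃ R, IsLocalKernel Q R K.val :=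
  Subtype.property (p := (· ∈ localKernels Q H)) K

theorem ext {K L : KernelAlg Q H} (h : K.val = L.val) : K = L :=
  Subtype.ext (p := (· ∈ localKernels Q H)) h

instance : Mul (KernelAlg Q H) where
  mul K L := ⟨fun x y => ∑' z, K.val x z * L.val z y, by
    obtain ⟨R, hK⟩ := K.exists_isLocalKernel
    obtain ⟨S, hL⟩ := L.exists_isLocalKernel
    exact ⟨_, (hK.mono (le_max_left R S)).mul (hL.mono (le_max_right R S))⟩⟩

instance : Star (KernelAlg Q H) where
  star K := ⟨fun x y => star (K.val y x), by
    obtain ⟨R, hK⟩ := K.exists_isLocalKernel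
    exact ⟨_, hK.star⟩⟩

/-- The operator on `ℓ²(Γ/H)` given by a local kernel, `(K f)(x) = ∑ y, K(x, y) f(y)`. -/
def op (K : KernelAlg Q H) : BL2 (Γ ⧸ H) :=
  matrixOp K.val K.exists_isLocalKernel.choose_spec.isBanded

theorem op_injective : Function.Injective (op : KernelAlg Q H → BL2 (Γ ⧸ H)) :=
  fun _ _ h => ext (matrixOp_injective _ _ h)

theorem op_add (K L : KernelAlg Q H) : (K + L).op = K.op + L.op :=
  matrixOp_add _ _ _ fun _ _ => rfl

theorem op_smul (c : ℂ) (K : KernelAlg Q H) : (c • K).op = c • K.op :=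
  matrixOp_smul c _ _ fun _ _ => rfl

theorem op_mul (K L : KernelAlg Q H) : (K * L).op = K.op * L.op :=
  matrixOp_mul _ _ _ fun _ _ => rfl

theorem op_star (K : KernelAlg Q H) : (star K).op = star K.op :=
  matrixOp_star _ _ fun _ _ => rfl

theorem op_zero : (0 : KernelAlg Q H).op = 0 := by
  simpa using op_smul 0 (0 : KernelAlg Q H)

instance : NonUnitalRing (KernelAlg Q H) where
  left_distrib K L M := op_injective (by simp only [op_add, op_mul, mul_add])
  right_distrib K L M := op_injective (by simp only [op_add, op_mul, add_mul])
  zero_mul K := op_injective (by simp only [op_zero, op_mul, zero_mul])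
  mul_zero K := op_injective (by simp only [op_zero, op_mul, mul_zero])
  mul_assoc K L M := op_injective (by simp only [op_mul, mul_assoc])

instance : StarRing (KernelAlg Q H) where
  star_involutive K := op_injective (by simp only [op_star, star_star])
  star_mul K L := op_injective (by simp only [op_star, op_mul, star_mul])
  star_add K L := op_injective (by simp only [op_star, op_add, star_add])

instance : StarModule ℂ (KernelAlg Q H) where
  star_smul c K := op_injective (by simp only [op_star, op_smul, star_smul])

instance : IsScalarTower ℂ (KernelAlg Q H) (KernelAlg Q H) where
  smul_assoc c K L := op_injective (by simp only [smul_eq_mul, op_mul, op_smul, smul_mul_assoc])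

instance : SMulCommClass ℂ (KernelAlg Q H) (KernelAlg Q H) where
  smul_comm c K L := op_injective (by simp only [smul_eq_mul, op_mul, op_smul, mul_smul_comm])

variable (Q H)

/-- The regular representation of the local kernel algebra on `ℓ²(Γ/H)`. -/
def regularRep : KernelAlg Q H →⋆ₙₐ[ℂ] BL2 (Γ ⧸ H) where
  toFun := op
  map_smul' := op_smul
  map_zero' := op_zero
  map_add' := op_add
  map_mul' := op_mul
  map_star' := op_star

/-- The reduced C*-algebra of the uniformly recurrent subgroup: the completion of the local kernel
algebra in the operator norm of its (faithful) regular representation, realised as the norm closure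
of the image of the representation. -/
def reducedCStar : NonUnitalStarSubalgebra ℂ (BL2 (Γ ⧸ H)) :=
  (NonUnitalStarAlgHom.range (regularRep Q H)).topologicalClosure

instance : NonUnitalCStarAlgebra (reducedCStar Q H) :=
  NonUnitalStarSubalgebra.nonUnitalCStarAlgebra _
    (h_closed := NonUnitalStarSubalgebra.isClosed_topologicalClosure _)

variable {Q H}

/-- The canonical map from the local kernel algebra to its completion. -/
def toReduced (K : KernelAlg Q H) : reducedCStar Q H :=
  ⟨regularRep Q H K, NonUnitalStarSubalgebra.le_topologicalClosure _ ⟨K, rfl⟩⟩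

end KernelAlg


/-- The connecting map between the sets of isomorphism classes of `(n+1)`-balls and `n`-balls. -/
def BallClass.res {n : ℕ} (c : BallClass Q H (n + 1)) : BallClass Q H n :=
  Quotient.map (sa := vertexSetoid Q H (n + 1)) (sb := vertexSetoid Q H n) id
    (fun _ _ h => BallEquiv.restrict h (Nat.le_succ n)) c

instance (n : ℕ) : TopologicalSpace (BallClass Q H n) := ⊥

instance (n : ℕ) : DiscreteTopology (BallClass Q H n) := ⟨rfl⟩

/-- The unit space: the projective limit of the finite discrete sets of isomorphism classes
of `n`-balls. -/
structure UnitSpace where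
  coord : ∀ n, BallClass Q H n
  compat : ∀ n, BallClass.res Q H (coord (n + 1)) = coord n

instance : TopologicalSpace (UnitSpace Q H) :=
  TopologicalSpace.induced UnitSpace.coord Pi.topologicalSpace

/-- Pairs `(x, y)` of vertices with `y` in the `n`-ball around `x` are identified along root-label
isomorphisms of `n`-balls. -/
def ballPointSetoid (n : ℕ) : Setoid {p : (Γ ⧸ H) × (Γ ⧸ H) // p.2 ∈ ball Q n p.1} where
  r p p' := ∃ θ, IsBallIso Q n p.1.1 p'.1.1 θ ∧ θ p.1.2 = p'.1.2
  iseqv := by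
    refine ⟨fun p => ⟨id, .refl n _, rfl⟩, ?_, ?_⟩
    · rintro p p' ⟨θ, hθ, e⟩
      obtain ⟨θ', hθ', e'⟩ := hθ.exists_symm
      exact ⟨θ', hθ', by rw [← e, e' _ p.2]⟩
    · rintro p p' p'' ⟨θ, hθ, e⟩ ⟨θ', hθ', e'⟩
      exact ⟨θ' ∘ θ, hθ.comp hθ', by simp [e, e']⟩

/-- The disjoint union, over all isomorphism classes of `n`-balls in the Schreier graph, of the
vertex set of the ball, together with an additional point `∞`. -/
def BallPoint (n : ℕ) : Type _ := Option (Quotient (ballPointSetoid Q H n))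

variable {Q H} in
/-- The additional point `∞` of level `n`. -/
def BallPoint.infty {n : ℕ} : BallPoint Q H n := (none : Option (Quotient (ballPointSetoid Q H n)))

variable {Q H} in
/-- The point of level `n` given by the vertex `y` in the `n`-ball around `x`. -/
def BallPoint.mk {n : ℕ} (x y : Γ ⧸ H) (h : y ∈ ball Q n x) : BallPoint Q H n :=
  some (Quotient.mk (ballPointSetoid Q H n) ⟨(x, y), h⟩)

instance (n : ℕ) : TopologicalSpace (BallPoint Q H n) := ⊥

instance (n : ℕ) : DiscreteTopology (BallPoint Q H n) := ⟨rfl⟩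

variable {H} in
open Classical in
/-- The point of level `n` given by the vertex `y` in the `n`-ball around `x`, which is `∞` if `y`
does not belong to this ball. -/
def ballPoint (n : ℕ) (x y : Γ ⧸ H) : BallPoint Q H n :=
  if h : y ∈ ball Q n x then .mk x y h else .infty

variable {Q H}

theorem ballPoint_of_mem {n : ℕ} {x y : Γ ⧸ H} (h : y ∈ ball Q n x) :
    ballPoint Q n x y = .mk x y h := dif_pos h

theorem ballPoint_of_notMem {n : ℕ} {x y : Γ ⧸ H} (h : y ∉ ball Q n x) :
    ballPoint Q n x y = .infty := dif_neg h

theorem ballPoint_ne_infty {n : ℕ} {x y : Γ ⧸ H} :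
    ballPoint Q n x y ≠ .infty ↔ y ∈ ball Q n x := by
  by_cases h : y ∈ ball Q n x
  · rw [ballPoint_of_mem h]
    exact iff_of_true (fun h' => Option.some_ne_none _ h') h
  · rw [ballPoint_of_notMem h]
    exact iff_of_false (fun h' => h' rfl) h

theorem ballPoint_eq_of_iso {m n : ℕ} {x x' y : Γ ⧸ H} {θ : Γ ⧸ H → Γ ⧸ H}
    (hθ : IsBallIso Q m x x' θ) (hn : n ≤ m) (hy : y ∈ ball Q m x) :
    ballPoint Q n x y = ballPoint Q n x' (θ y) := by
  by_cases h : y ∈ ball Q n x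
  · rw [ballPoint_of_mem h, ballPoint_of_mem ((hθ.mem_ball_iff hn hy).mpr h)]
    exact congrArg some (Quotient.sound ⟨θ, hθ.restrict hn, rfl⟩)
  · rw [ballPoint_of_notMem h, ballPoint_of_notMem]
    rwa [hθ.mem_ball_iff hn hy]

theorem exists_iso_of_ballPoint_eq {n : ℕ} {x x' y y' : Γ ⧸ H} (hy : y ∈ ball Q n x)
    (h : ballPoint Q n x y = ballPoint Q n x' y') :
    y' ∈ ball Q n x' ∧ ∃ θ, IsBallIso Q n x x' θ ∧ θ y = y' := by
  have hy' : y' ∈ ball Q n x' := by rw [← ballPoint_ne_infty, ← h]; exact ballPoint_ne_infty.mpr hy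
  refine ⟨hy', ?_⟩
  rw [ballPoint_of_mem hy, ballPoint_of_mem hy'] at h
  exact Quotient.exact (Option.some.inj h)

theorem exists_ballPoint {n : ℕ} {c : BallPoint Q H n} (hc : c ≠ .infty) :
    ∃ x y, y ∈ ball Q n x ∧ c = ballPoint Q n x y := by
  obtain ⟨c, rfl⟩ := Option.ne_none_iff_exists.mp hc
  obtain ⟨⟨⟨x, y⟩, h⟩, rfl⟩ := Quotient.exists_rep c
  exact ⟨x, y, h, (ballPoint_of_mem h).symm⟩

variable (Q H) in
/-- The connecting map from level `n + 1` to level `n`: a vertex of an `(n+1)`-ball is sent to the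
same vertex of the concentric `n`-ball if it belongs to that ball, and to `∞` otherwise;
the point `∞` is sent to `∞`. -/
def BallPoint.res {n : ℕ} (c : BallPoint Q H (n + 1)) : BallPoint Q H n :=
  Option.elim c .infty (Quotient.lift (s := ballPointSetoid Q H (n + 1))
    (fun p => ballPoint Q n p.1.1 p.1.2) (by
      rintro p p' ⟨θ, hθ, e⟩
      rw [← e]
      exact ballPoint_eq_of_iso hθ (Nat.le_succ n) p.2))

theorem res_ballPoint (n : ℕ) (x y : Γ ⧸ H) :
    BallPoint.res Q H (ballPoint Q (n + 1) x y) = ballPoint Q n x y := by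
  by_cases h : y ∈ ball Q (n + 1) x
  · rw [ballPoint_of_mem h]; rfl
  · rw [ballPoint_of_notMem h, ballPoint_of_notMem fun h' => h (ball_mono (Nat.le_succ n) x h')]
    rfl

variable (Q H)

/-- The space of arrows of the groupoid: the projective limit of the discrete spaces
`BallPoint Q H n`, without the point all of whose components are `∞`. -/
structure Arrow where
  coord : ∀ n, BallPoint Q H n
  compat : ∀ n, BallPoint.res Q H (coord (n + 1)) = coord n
  ne_infty : ∃ n, coord n ≠ .infty

instance : TopologicalSpace (Arrow Q H) :=
  TopologicalSpace.induced Arrow.coord Pi.topologicalSpace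

variable {Q H}

theorem res_ballClass (n : ℕ) (p : Γ ⧸ H) :
    BallClass.res Q H (ballClass Q (n + 1) p) = ballClass Q n p := rfl

namespace UnitSpace

theorem ext {x y : UnitSpace Q H} (h : ∀ n, x.coord n = y.coord n) : x = y := by
  cases x; cases y
  congr
  exact funext h

theorem coord_mono {x : UnitSpace Q H} {m n : ℕ} (h : n ≤ m) {p : Γ ⧸ H}
    (hp : x.coord m = ballClass Q m p) : x.coord n = ballClass Q n p := by
  induction m, h using Nat.le_induction with
  | base => exact hp
  | succ m _ ih => exact ih (by rw [← x.compat m, hp, res_ballClass])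

/-- A vertex representing the `n`-th coordinate of a unit. -/
def rep (x : UnitSpace Q H) (n : ℕ) : Γ ⧸ H := (ballClass_surjective (x.coord n)).choose

theorem coord_rep (x : UnitSpace Q H) (n : ℕ) : x.coord n = ballClass Q n (x.rep n) :=
  (ballClass_surjective (x.coord n)).choose_spec.symm

/-- The translate `γ x`: if `x` is given by vertices `x 0, x 1, …` then `γ x` is given
by the vertices `γ (x l), γ (x (l + 1)), …` where `l` is the length of `γ`. -/
def act (γ : Γ) (x : UnitSpace Q H) : UnitSpace Q H :=
  ⟨fun n => ballClass Q n (γ • x.rep (n + wordLength Q γ)), fun n => by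
    rw [res_ballClass, ballClass_eq]
    have h := coord_mono (n := n + wordLength Q γ) (by omega) (x.coord_rep (n + 1 + wordLength Q γ))
    rw [x.coord_rep, ballClass_eq] at h
    obtain ⟨θ, hθ⟩ := h.symm
    exact ⟨θ, hθ.restrict_smul (mem_words_wordLength Q γ) le_rfl⟩⟩

theorem act_coord {γ : Γ} {x : UnitSpace Q H} {n k m : ℕ} (hγ : γ ∈ words Q k) (hm : n + k ≤ m)
    {p : Γ ⧸ H} (hp : x.coord m = ballClass Q m p) : (x.act γ).coord n = ballClass Q n (γ • p) := by
  change ballClass Q n (γ • x.rep (n + wordLength Q γ)) = _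
  have hle : wordLength Q γ ≤ k := Nat.sInf_le hγ
  have h := coord_mono (n := n + wordLength Q γ) (by omega) hp
  rw [x.coord_rep, ballClass_eq] at h
  obtain ⟨θ, hθ⟩ := h
  rw [ballClass_eq]
  exact ⟨θ, hθ.restrict_smul (mem_words_wordLength Q γ) le_rfl⟩

theorem act_one (x : UnitSpace Q H) : x.act 1 = x := ext fun n => by
  rw [act_coord (one_mem_words 0) le_rfl (x.coord_rep (n + 0)), one_smul]
  exact (coord_mono (by omega) (x.coord_rep (n + 0))).symm

theorem act_act (x : UnitSpace Q H) (γ δ : Γ) : (x.act γ).act δ = x.act (δ * γ) := ext fun n => by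
  have hγ := mem_words_wordLength Q γ
  have hδ := mem_words_wordLength Q δ
  have hx := x.coord_rep (n + wordLength Q δ + wordLength Q γ)
  rw [act_coord hδ le_rfl (act_coord hγ le_rfl hx),
    act_coord (mul_mem_words hδ hγ) (by omega) hx, mul_smul]

/-- `x.Same γ δ`: paths described by `γ` and `δ` that start at `x` lead to the same vertex. -/
def Same (x : UnitSpace Q H) (γ δ : Γ) : Prop :=
  ∃ m p, γ ∈ words Q m ∧ δ ∈ words Q m ∧ x.coord m = ballClass Q m p ∧ γ • p = δ • p

theorem Same.smul_eq {x : UnitSpace Q H} {γ δ : Γ} (h : x.Same γ δ) {m : ℕ} {p : Γ ⧸ H}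
    (hγ : γ ∈ words Q m) (hδ : δ ∈ words Q m) (hp : x.coord m = ballClass Q m p) :
    γ • p = δ • p := by
  obtain ⟨m', p', hγ', hδ', hp', e⟩ := h
  have hx := x.coord_rep (max m m')
  have h1 := coord_mono (le_max_left m m') hx
  have h2 := coord_mono (le_max_right m m') hx
  rw [hp, ballClass_eq] at h1
  rw [hp', ballClass_eq] at h2
  obtain ⟨θ, hθ⟩ := h1
  obtain ⟨θ', hθ'⟩ := h2
  exact (hθ.smul_eq_iff hγ hδ).mpr ((hθ'.smul_eq_iff hγ' hδ').mp e)

theorem Same.refl (x : UnitSpace Q H) (γ : Γ) : x.Same γ γ :=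
  ⟨_, _, mem_words_wordLength Q γ, mem_words_wordLength Q γ, x.coord_rep _, rfl⟩

theorem Same.symm {x : UnitSpace Q H} {γ δ : Γ} (h : x.Same γ δ) : x.Same δ γ := by
  obtain ⟨m, p, h1, h2, h3, h4⟩ := h
  exact ⟨m, p, h2, h1, h3, h4.symm⟩

theorem Same.trans {x : UnitSpace Q H} {γ δ ε : Γ} (h : x.Same γ δ) (h' : x.Same δ ε) :
    x.Same γ ε := by
  obtain ⟨a, ha⟩ := exists_mem_words Q γ
  obtain ⟨b, hb⟩ := exists_mem_words Q δ
  obtain ⟨c, hc⟩ := exists_mem_words Q ε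
  have ha : γ ∈ words Q (a + b + c) := words_mono (by omega) ha
  have hb : δ ∈ words Q (a + b + c) := words_mono (by omega) hb
  have hc : ε ∈ words Q (a + b + c) := words_mono (by omega) hc
  have hx := x.coord_rep (a + b + c)
  exact ⟨_, _, ha, hc, hx, (h.smul_eq ha hb hx).trans (h'.smul_eq hb hc hx)⟩

theorem Same.act_eq {x : UnitSpace Q H} {γ δ : Γ} (h : x.Same γ δ) : x.act γ = x.act δ :=
  ext fun n => by
    obtain ⟨a, ha⟩ := exists_mem_words Q γ
    obtain ⟨b, hb⟩ := exists_mem_words Q δ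
    have ha : γ ∈ words Q (a + b) := words_mono (by omega) ha
    have hb : δ ∈ words Q (a + b) := words_mono (by omega) hb
    have hx := x.coord_rep (n + (a + b))
    rw [act_coord ha le_rfl hx, act_coord hb le_rfl hx,
      h.smul_eq (words_mono (by omega) ha) (words_mono (by omega) hb) hx]

theorem Same.mul_left {x : UnitSpace Q H} {γ δ : Γ} (h : x.Same γ δ) (ε : Γ) :
    x.Same (ε * γ) (ε * δ) := by
  obtain ⟨a, ha⟩ := exists_mem_words Q γ
  obtain ⟨b, hb⟩ := exists_mem_words Q δ
  obtain ⟨c, hc⟩ := exists_mem_words Q ε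
  have hx := x.coord_rep (c + (a + b))
  have ha : γ ∈ words Q (a + b) := words_mono (by omega) ha
  have hb : δ ∈ words Q (a + b) := words_mono (by omega) hb
  refine ⟨_, _, mul_mem_words hc ha, mul_mem_words hc hb, hx, ?_⟩
  rw [mul_smul, mul_smul, h.smul_eq (words_mono (by omega) ha) (words_mono (by omega) hb) hx]

theorem Same.mul_right {x : UnitSpace Q H} {γ δ ε : Γ} (h : (x.act ε).Same γ δ) :
    x.Same (γ * ε) (δ * ε) := by
  obtain ⟨a, ha⟩ := exists_mem_words Q γ
  obtain ⟨b, hb⟩ := exists_mem_words Q δ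
  obtain ⟨c, hc⟩ := exists_mem_words Q ε
  have hx := x.coord_rep (a + b + c)
  have ha : γ ∈ words Q (a + b) := words_mono (by omega) ha
  have hb : δ ∈ words Q (a + b) := words_mono (by omega) hb
  refine ⟨_, _, mul_mem_words ha hc, mul_mem_words hb hc, hx, ?_⟩
  rw [mul_smul, mul_smul]
  exact h.smul_eq ha hb (act_coord hc le_rfl hx)

end UnitSpace

namespace Arrow

theorem coord_mono {a : Arrow Q H} {m n : ℕ} (h : n ≤ m) {p q : Γ ⧸ H}
    (hp : a.coord m = ballPoint Q m p q) : a.coord n = ballPoint Q n p q := by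
  induction m, h using Nat.le_induction with
  | base => exact hp
  | succ m _ ih => exact ih (by rw [← a.compat m, hp, res_ballPoint])

theorem ne_infty_mono {a : Arrow Q H} {m n : ℕ} (h : n ≤ m) (hn : a.coord n ≠ .infty) :
    a.coord m ≠ .infty := by
  induction m, h using Nat.le_induction with
  | base => exact hn
  | succ m _ ih =>
    intro h0
    apply ih
    rw [← a.compat m, h0]
    rfl

theorem ext_of_le {a b : Arrow Q H} (N : ℕ) (h : ∀ n, N ≤ n → a.coord n = b.coord n) : a = b := by
  suffices h' : ∀ n, a.coord n = b.coord n by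
    cases a; cases b
    congr
    exact funext h'
  intro n
  suffices ∀ k, a.coord (N - k) = b.coord (N - k) by
    rcases le_total N n with hn | hn
    · exact h n hn
    · have := this (N - n)
      rwa [Nat.sub_sub_self hn] at this
  intro k
  induction k with
  | zero => exact h _ le_rfl
  | succ k ih =>
    rcases Nat.lt_or_ge k N with hk | hk
    · have e : N - k = N - (k + 1) + 1 := by omega
      rw [e] at ih
      rw [← a.compat, ← b.compat, ih]
    · have e : N - k = N - (k + 1) := by omega
      rwa [e] at ih

end Arrow

/-- The arrow represented by the pair `(x, γ)`. Its component of level `n` is the vertex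
`γ (x m)` in the `n`-ball around `x m`, or `∞` if this vertex does not belong to the `n`-ball,
where `m` is the maximum of `n` and the length of `γ`. -/
def arrow (x : UnitSpace Q H) (γ : Γ) : Arrow Q H where
  coord n := ballPoint Q n (x.rep (max n (wordLength Q γ))) (γ • x.rep (max n (wordLength Q γ)))
  compat n := by
    have h := UnitSpace.coord_mono (n := max n (wordLength Q γ)) (by omega)
      (x.coord_rep (max (n + 1) (wordLength Q γ)))
    rw [x.coord_rep, ballClass_eq] at h
    obtain ⟨θ, hθ⟩ := h.symm
    have hγ : γ ∈ words Q (max n (wordLength Q γ)) :=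
      mem_words_of_wordLength_le (le_max_right _ _)
    rw [res_ballPoint, ballPoint_eq_of_iso hθ (le_max_left _ _), hθ.map_smul hγ]
    have := smul_mem_ball hγ (x.rep (max (n + 1) (wordLength Q γ)))
    exact this
  ne_infty := by
    refine ⟨wordLength Q γ, ?_⟩
    rw [ballPoint_ne_infty, max_self]
    exact smul_mem_ball (mem_words_wordLength Q γ) _

theorem arrow_coord {x : UnitSpace Q H} {γ : Γ} {m n : ℕ} (hn : n ≤ m) (hγ : γ ∈ words Q m)
    {p : Γ ⧸ H} (hp : x.coord m = ballClass Q m p) :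
    (arrow x γ).coord n = ballPoint Q n p (γ • p) := by
  change ballPoint Q n _ _ = _
  have hl : wordLength Q γ ≤ m := Nat.sInf_le hγ
  have hle : max n (wordLength Q γ) ≤ m := by omega
  have h := UnitSpace.coord_mono hle hp
  rw [x.coord_rep, ballClass_eq] at h
  obtain ⟨θ, hθ⟩ := h
  have hγ' : γ ∈ words Q (max n (wordLength Q γ)) := mem_words_of_wordLength_le (le_max_right _ _)
  rw [ballPoint_eq_of_iso hθ (le_max_left _ _) (smul_mem_ball hγ' _), hθ.map_smul hγ']

theorem arrow_eq_iff {x y : UnitSpace Q H} {γ δ : Γ} :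
    arrow x γ = arrow y δ ↔ x = y ∧ x.Same γ δ := by
  obtain ⟨i, hi⟩ := exists_mem_words Q γ
  obtain ⟨j, hj⟩ := exists_mem_words Q δ
  constructor
  · intro h
    have key : ∀ m, i + j ≤ m → ∃ θ, IsBallIso Q m (x.rep m) (y.rep m) θ ∧
        θ (γ • x.rep m) = δ • y.rep m := by
      intro m hm
      have hγ : γ ∈ words Q m := words_mono (by omega) hi
      have hδ : δ ∈ words Q m := words_mono (by omega) hj
      have e := congrArg (fun a : Arrow Q H => a.coord m) h
      simp only [arrow_coord le_rfl hγ (x.coord_rep m), arrow_coord le_rfl hδ (y.coord_rep m)] at e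
      exact (exists_iso_of_ballPoint_eq (smul_mem_ball hγ _) e).2
    have hxy : x = y := by
      refine UnitSpace.ext fun n => ?_
      obtain ⟨θ, hθ, -⟩ := key (n + (i + j)) (by omega)
      rw [UnitSpace.coord_mono (by omega) (x.coord_rep (n + (i + j))),
        UnitSpace.coord_mono (by omega) (y.coord_rep (n + (i + j))), ballClass_eq]
      exact ⟨θ, hθ.restrict (by omega)⟩
    subst hxy
    obtain ⟨θ, hθ, e⟩ := key (i + j) le_rfl
    have hγ : γ ∈ words Q (i + j) := words_mono (by omega) hi
    have hδ : δ ∈ words Q (i + j) := words_mono (by omega) hj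
    refine ⟨rfl, i + j, _, hγ, hδ, x.coord_rep _, ?_⟩
    rw [← e, hθ.map_smul hγ]
  · rintro ⟨rfl, h⟩
    refine Arrow.ext_of_le (i + j) fun n hn => ?_
    have hγ : γ ∈ words Q n := words_mono (by omega) hi
    have hδ : δ ∈ words Q n := words_mono (by omega) hj
    rw [arrow_coord le_rfl hγ (x.coord_rep n), arrow_coord le_rfl hδ (x.coord_rep n),
      h.smul_eq hγ hδ (x.coord_rep n)]

theorem exists_arrow_of_ne_infty {a : Arrow Q H} {N : ℕ} (hN : a.coord N ≠ .infty) {p₀ : Γ ⧸ H} {γ : Γ}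
    (hγ : γ ∈ words Q N) (h0 : a.coord N = ballPoint Q N p₀ (γ • p₀)) :
    ∃ x, a = arrow x γ := by
  have key : ∀ n, ∃ p q, N ≤ n → q ∈ ball Q n p ∧ a.coord n = ballPoint Q n p q := by
    intro n
    rcases le_total N n with hn | hn
    · obtain ⟨p, q, h1, h2⟩ := exists_ballPoint (Arrow.ne_infty_mono hn hN)
      exact ⟨p, q, fun _ => ⟨h1, h2⟩⟩
    · rcases eq_or_lt_of_le hn with rfl | hn
      · obtain ⟨p, q, h1, h2⟩ := exists_ballPoint hN
        exact ⟨p, q, fun _ => ⟨h1, h2⟩⟩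
      · exact ⟨p₀, p₀, fun h => absurd h (by omega)⟩
  choose p q hpq using key
  have hmem : ∀ n, N ≤ n → q n ∈ ball Q n (p n) := fun n hn => (hpq n hn).1
  have hco : ∀ n, N ≤ n → a.coord n = ballPoint Q n (p n) (q n) := fun n hn => (hpq n hn).2
  have hq : ∀ n, N ≤ n → q n = γ • p n := by
    intro n hn
    have e := Arrow.coord_mono hn (hco n hn)
    rw [h0] at e
    obtain ⟨hb, θ, hθ, e'⟩ := exists_iso_of_ballPoint_eq (smul_mem_ball hγ p₀) e
    rw [← e', hθ.map_smul hγ]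
  have hequiv : ∀ n, N ≤ n → BallEquiv Q n (p (n + 1)) (p n) := by
    intro n hn
    have e := Arrow.coord_mono (Nat.le_succ n) (hco (n + 1) (by omega))
    rw [hco n hn] at e
    obtain ⟨_, θ, hθ, -⟩ := exists_iso_of_ballPoint_eq (hmem n hn) e
    exact BallEquiv.symm ⟨θ, hθ⟩
  refine ⟨⟨fun n => ballClass Q n (p (max n N)), fun n => ?_⟩, ?_⟩
  · rw [res_ballClass, ballClass_eq]
    rcases Nat.lt_or_ge n N with hn | hn
    · rw [max_eq_right (by omega), max_eq_right (by omega)]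
      exact BallEquiv.refl _ _
    · rw [max_eq_left (by omega), max_eq_left (by omega)]
      exact hequiv n hn
  · refine Arrow.ext_of_le N fun n hn => ?_
    rw [arrow_coord le_rfl (words_mono hn hγ) (p := p n) (by change ballClass Q n _ = _; rw [max_eq_left hn]), hco n hn,
      hq n hn]

theorem Arrow.exists_rep_of_ne_infty {a : Arrow Q H} {N : ℕ} (hN : a.coord N ≠ .infty) :
    ∃ x, ∃ γ ∈ words Q N, a = arrow x γ := by
  obtain ⟨p, _, ⟨γ, hγ, rfl⟩, h⟩ := exists_ballPoint hN
  obtain ⟨x, hx⟩ := exists_arrow_of_ne_infty hN hγ h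
  exact ⟨x, γ, hγ, hx⟩

/-- Every arrow is represented by a pair `(x, γ)`. -/
theorem Arrow.exists_rep (a : Arrow Q H) : ∃ (x : UnitSpace Q H) (γ : Γ), a = arrow x γ := by
  obtain ⟨N, hN⟩ := a.ne_infty
  obtain ⟨x, γ, -, h⟩ := Arrow.exists_rep_of_ne_infty hN
  exact ⟨x, γ, h⟩

theorem arrow_ne_infty {x : UnitSpace Q H} {γ : Γ} {N : ℕ} (hγ : γ ∈ words Q N) :
    (arrow x γ).coord N ≠ .infty := by
  rw [arrow_coord le_rfl hγ (x.coord_rep N)]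
  exact ballPoint_ne_infty.mpr (smul_mem_ball hγ _)

namespace Arrow

/-- The range of an arrow: `r(x, γ) = x`. -/
def range (a : Arrow Q H) : UnitSpace Q H := a.exists_rep.choose

/-- Some `γ` such that the arrow is represented by `(x, γ)`, where `x` is its range. -/
def label (a : Arrow Q H) : Γ := a.exists_rep.choose_spec.choose

theorem eq_arrow (a : Arrow Q H) : a = arrow a.range a.label := a.exists_rep.choose_spec.choose_spec

/-- The source of an arrow: `s(x, γ) = γ x`. -/
def source (a : Arrow Q H) : UnitSpace Q H := a.range.act a.label

/-- The product of arrows: `(y, γ')(x, γ) = (y, γ γ')` if `x = γ' y`. It is only meaningful if the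
source of the first arrow is the range of the second one. -/
def comp (a b : Arrow Q H) : Arrow Q H := arrow a.range (b.label * a.label)

/-- The inverse of an arrow: `(x, γ)⁻¹ = (γ x, γ⁻¹)`. -/
def inverse (a : Arrow Q H) : Arrow Q H := arrow a.source a.label⁻¹

/-- The unit arrow `(x, e)` at `x`. -/
def unit (x : UnitSpace Q H) : Arrow Q H := arrow x 1

theorem range_arrow (x : UnitSpace Q H) (γ : Γ) : (arrow x γ).range = x :=
  (arrow_eq_iff.mp (arrow x γ).eq_arrow).1.symm

theorem same_label (x : UnitSpace Q H) (γ : Γ) : x.Same γ (arrow x γ).label :=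
  (arrow_eq_iff.mp (arrow x γ).eq_arrow).2

theorem source_arrow (x : UnitSpace Q H) (γ : Γ) : (arrow x γ).source = x.act γ := by
  rw [source, range_arrow, (same_label x γ).act_eq]

theorem comp_arrow (x : UnitSpace Q H) (γ δ : Γ) :
    (arrow x γ).comp (arrow (x.act γ) δ) = arrow x (δ * γ) := by
  rw [comp, range_arrow, arrow_eq_iff]
  refine ⟨rfl, ?_⟩
  exact (((same_label x γ).symm.mul_left _)).trans (same_label (x.act γ) δ).symm.mul_right

theorem inverse_arrow (x : UnitSpace Q H) (γ : Γ) :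
    (arrow x γ).inverse = arrow (x.act γ) γ⁻¹ := by
  rw [inverse, source_arrow, arrow_eq_iff]
  refine ⟨rfl, ?_⟩
  have h := (same_label x γ)
  set δ := (arrow x γ).label
  have h1 : x.Same (δ⁻¹ * γ) (γ⁻¹ * γ) := by
    have := h.mul_left δ⁻¹
    rw [inv_mul_cancel δ] at this
    rwa [inv_mul_cancel γ]
  have h2 : ((x.act γ).act γ⁻¹).Same (δ⁻¹ * γ) (γ⁻¹ * γ) := by
    rw [UnitSpace.act_act, inv_mul_cancel, UnitSpace.act_one]
    rwa [inv_mul_cancel γ] at h1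
  have h3 := h2.mul_right
  rwa [mul_assoc, mul_inv_cancel, mul_one, mul_assoc, mul_inv_cancel, mul_one] at h3

variable {a b c : Arrow Q H}

theorem exists_rep_pair (h : a.source = b.range) :
    ∃ (x : UnitSpace Q H) (γ δ : Γ), a = arrow x γ ∧ b = arrow (x.act γ) δ := by
  obtain ⟨x, γ, rfl⟩ := a.exists_rep
  obtain ⟨y, δ, rfl⟩ := b.exists_rep
  rw [source_arrow, range_arrow] at h
  subst h
  exact ⟨x, γ, δ, rfl, rfl⟩

theorem range_comp (h : a.source = b.range) : (a.comp b).range = a.range := by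
  obtain ⟨x, γ, δ, rfl, rfl⟩ := exists_rep_pair h
  rw [comp_arrow, range_arrow, range_arrow]

theorem source_comp (h : a.source = b.range) : (a.comp b).source = b.source := by
  obtain ⟨x, γ, δ, rfl, rfl⟩ := exists_rep_pair h
  rw [comp_arrow, source_arrow, source_arrow, UnitSpace.act_act]

theorem range_inverse (a : Arrow Q H) : a.inverse.range = a.source := by
  obtain ⟨x, γ, rfl⟩ := a.exists_rep
  rw [inverse_arrow, range_arrow, source_arrow]

theorem source_inverse (a : Arrow Q H) : a.inverse.source = a.range := by
  obtain ⟨x, γ, rfl⟩ := a.exists_rep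
  rw [inverse_arrow, source_arrow, range_arrow, UnitSpace.act_act, inv_mul_cancel,
    UnitSpace.act_one]

theorem inverse_inverse (a : Arrow Q H) : a.inverse.inverse = a := by
  obtain ⟨x, γ, rfl⟩ := a.exists_rep
  rw [inverse_arrow, inverse_arrow, UnitSpace.act_act, inv_mul_cancel, UnitSpace.act_one, inv_inv]

theorem comp_assoc (h : a.source = b.range) (h' : b.source = c.range) :
    (a.comp b).comp c = a.comp (b.comp c) := by
  obtain ⟨x, γ, δ, rfl, rfl⟩ := exists_rep_pair h
  obtain ⟨y, ε, rfl⟩ := c.exists_rep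
  rw [source_arrow, range_arrow, UnitSpace.act_act] at h'
  subst h'
  rw [comp_arrow, comp_arrow, ← UnitSpace.act_act, comp_arrow, comp_arrow, mul_assoc]

theorem comp_inverse (a : Arrow Q H) : a.comp a.inverse = unit a.range := by
  obtain ⟨x, γ, rfl⟩ := a.exists_rep
  rw [inverse_arrow, comp_arrow, inv_mul_cancel, range_arrow, unit]

theorem inverse_comp (a : Arrow Q H) : a.inverse.comp a = unit a.source := by
  have := comp_inverse a.inverse
  rwa [inverse_inverse, range_inverse] at this

theorem unit_comp (a : Arrow Q H) : (unit a.range).comp a = a := by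
  obtain ⟨x, γ, rfl⟩ := a.exists_rep
  have := comp_arrow x 1 γ
  rw [UnitSpace.act_one, mul_one] at this
  rwa [range_arrow]

theorem comp_unit (a : Arrow Q H) : a.comp (unit a.source) = a := by
  obtain ⟨x, γ, rfl⟩ := a.exists_rep
  rw [source_arrow, unit, comp_arrow, one_mul]

theorem source_unit (x : UnitSpace Q H) : (unit x).source = x := by
  rw [unit, source_arrow, UnitSpace.act_one]

theorem range_unit (x : UnitSpace Q H) : (unit x).range = x := range_arrow x 1

end Arrow

/-! ### Topology of the groupoid -/

section Topology

theorem isOpen_coord_eq_unit (n : ℕ) (c : BallClass Q H n) :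
    IsOpen {x : UnitSpace Q H | x.coord n = c} := by
  have h : Continuous fun x : UnitSpace Q H => x.coord n :=
    (continuous_apply n).comp continuous_induced_dom
  exact (isOpen_discrete {c}).preimage h

theorem isOpen_coord_eq_arrow (n : ℕ) (c : BallPoint Q H n) :
    IsOpen {a : Arrow Q H | a.coord n = c} := by
  have h : Continuous fun a : Arrow Q H => a.coord n :=
    (continuous_apply n).comp continuous_induced_dom
  exact (isOpen_discrete {c}).preimage h

theorem isOpen_coord_ne_infty (n : ℕ) : IsOpen {a : Arrow Q H | a.coord n ≠ .infty} := by
  have h : Continuous fun a : Arrow Q H => a.coord n :=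
    (continuous_apply n).comp continuous_induced_dom
  exact (isOpen_discrete {c | c ≠ BallPoint.infty}).preimage h

instance : T2Space (Arrow Q H) := by
  refine T2Space.of_injective_continuous (f := Arrow.coord) (fun a b h => ?_)
    continuous_induced_dom
  cases a; cases b
  congr

instance : CompactSpace (UnitSpace Q H) := by
  have hind : Topology.IsInducing (UnitSpace.coord : UnitSpace Q H → _) := ⟨rfl⟩
  have hr : Set.range (UnitSpace.coord : UnitSpace Q H → _) =
      ⋂ n, {x : ∀ n, BallClass Q H n | BallClass.res Q H (x (n + 1)) = x n} := by
    ext x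
    simp only [Set.mem_range, Set.mem_iInter, Set.mem_ofPred_eq]
    exact ⟨fun ⟨y, hy⟩ => hy ▸ y.compat, fun h => ⟨⟨x, h⟩, rfl⟩⟩
  have hcl : IsClosed (Set.range (UnitSpace.coord : UnitSpace Q H → _)) := by
    rw [hr]
    refine isClosed_iInter fun n => isClosed_eq ?_ (continuous_apply n)
    exact continuous_of_discreteTopology.comp (continuous_apply (n + 1))
  rw [← isCompact_univ_iff, hind.isCompact_iff, Set.image_univ]
  exact hcl.isCompact

theorem continuous_act (γ : Γ) : Continuous fun x : UnitSpace Q H => x.act γ := by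
  refine continuous_induced_rng.mpr (continuous_pi fun n => ?_)
  refine continuous_iff_continuousAt.mpr fun x => ?_
  have hγ := mem_words_wordLength Q γ
  refine ContinuousAt.congr (f := fun _ => (x.act γ).coord n) continuousAt_const ?_
  filter_upwards [(isOpen_coord_eq_unit (n + wordLength Q γ)
    (x.coord (n + wordLength Q γ))).mem_nhds rfl] with y hy
  have hx := x.coord_rep (n + wordLength Q γ)
  exact (UnitSpace.act_coord hγ le_rfl hx).trans
    (UnitSpace.act_coord hγ le_rfl ((show y.coord _ = _ from hy).trans hx)).symm

theorem continuous_arrow (γ : Γ) : Continuous fun x : UnitSpace Q H => arrow x γ := by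
  refine continuous_induced_rng.mpr (continuous_pi fun n => ?_)
  refine continuous_iff_continuousAt.mpr fun x => ?_
  have hγ : γ ∈ words Q (max n (wordLength Q γ)) := mem_words_of_wordLength_le (le_max_right _ _)
  refine ContinuousAt.congr (f := fun _ => (arrow x γ).coord n) continuousAt_const ?_
  filter_upwards [(isOpen_coord_eq_unit (max n (wordLength Q γ))
    (x.coord (max n (wordLength Q γ)))).mem_nhds rfl] with y hy
  have hx := x.coord_rep (max n (wordLength Q γ))
  exact (arrow_coord (le_max_left _ _) hγ hx).trans
    (arrow_coord (le_max_left _ _) hγ ((show y.coord _ = _ from hy).trans hx)).symm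

/-- Near `(x, γ)`, every arrow is of the form `(y, γ)`. -/
theorem eventually_eq_arrow (x : UnitSpace Q H) (γ : Γ) (n : ℕ) :
    ∀ᶠ a in nhds (arrow x γ), a = arrow a.range γ ∧ a.range.coord n = x.coord n := by
  set m := max n (wordLength Q γ) with hm
  have hγ : γ ∈ words Q m := mem_words_of_wordLength_le (le_max_right _ _)
  filter_upwards [(isOpen_coord_eq_arrow m ((arrow x γ).coord m)).mem_nhds rfl] with a ha
  have ha : a.coord m = (arrow x γ).coord m := ha
  have hx := x.coord_rep m
  have hN : a.coord m ≠ .infty := by rw [ha]; exact arrow_ne_infty hγ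
  rw [arrow_coord le_rfl hγ hx] at ha
  obtain ⟨y, rfl⟩ := exists_arrow_of_ne_infty hN hγ ha
  rw [Arrow.range_arrow]
  refine ⟨rfl, ?_⟩
  have hy := y.coord_rep m
  rw [arrow_coord le_rfl hγ hy] at ha
  obtain ⟨_, θ, hθ, -⟩ := exists_iso_of_ballPoint_eq (smul_mem_ball hγ _) ha
  rw [UnitSpace.coord_mono (le_max_left _ _) hy, UnitSpace.coord_mono (le_max_left _ _) hx,
    ballClass_eq]
  exact ⟨θ, hθ.restrict (le_max_left _ _)⟩

theorem continuous_range : Continuous (Arrow.range : Arrow Q H → UnitSpace Q H) := by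
  refine continuous_induced_rng.mpr (continuous_pi fun n => ?_)
  refine continuous_iff_continuousAt.mpr fun a => ?_
  obtain ⟨x, γ, rfl⟩ := a.exists_rep
  refine ContinuousAt.congr (f := fun _ => x.coord n) continuousAt_const ?_
  filter_upwards [eventually_eq_arrow x γ n] with a ha
  exact ha.2.symm

/-- A function on the arrows is continuous if `x ↦ f(x, γ)` is continuous for every `γ`. -/
theorem continuous_of_arrow {Y : Type*} [TopologicalSpace Y] {f : Arrow Q H → Y}
    (h : ∀ γ, Continuous fun x => f (arrow x γ)) : Continuous f := by
  refine continuous_iff_continuousAt.mpr fun a => ?_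
  obtain ⟨x, γ, rfl⟩ := a.exists_rep
  have hc : Continuous fun a : Arrow Q H => f (arrow a.range γ) := (h γ).comp continuous_range
  refine hc.continuousAt.congr ?_
  filter_upwards [eventually_eq_arrow x γ 0] with a ha
  exact congrArg f ha.1.symm

theorem eventually_same_iff (x : UnitSpace Q H) (γ δ : Γ) :
    ∀ᶠ y in nhds x, (y.Same γ δ ↔ x.Same γ δ) := by
  obtain ⟨i, hi⟩ := exists_mem_words Q γ
  obtain ⟨j, hj⟩ := exists_mem_words Q δ
  have hγ : γ ∈ words Q (i + j) := words_mono (by omega) hi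
  have hδ : δ ∈ words Q (i + j) := words_mono (by omega) hj
  filter_upwards [(isOpen_coord_eq_unit (i + j) (x.coord (i + j))).mem_nhds rfl] with y hy
  have hx := x.coord_rep (i + j)
  have hy : y.coord (i + j) = ballClass Q (i + j) (x.rep (i + j)) := Eq.trans hy hx
  exact ⟨fun h => ⟨_, _, hγ, hδ, hx, h.smul_eq hγ hδ hy⟩,
    fun h => ⟨_, _, hγ, hδ, hy, h.smul_eq hγ hδ hx⟩⟩

theorem isCompact_coord_ne_infty (n : ℕ) : IsCompact {a : Arrow Q H | a.coord n ≠ .infty} := by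
  have : {a : Arrow Q H | a.coord n ≠ .infty} =
      ⋃ γ ∈ words Q n, Set.range fun x : UnitSpace Q H => arrow x γ := by
    ext a
    simp only [Set.mem_ofPred_eq, Set.mem_iUnion, Set.mem_range, exists_prop]
    constructor
    · intro h
      obtain ⟨x, γ, hγ, rfl⟩ := Arrow.exists_rep_of_ne_infty h
      exact ⟨γ, hγ, x, rfl⟩
    · rintro ⟨γ, hγ, x, rfl⟩
      exact arrow_ne_infty hγ
  rw [this]
  exact (words_finite Q n).isCompact_biUnion fun γ _ => isCompact_range (continuous_arrow γ)

theorem exists_support_bound {f : Arrow Q H → ℂ} (hf : HasCompactSupport f) :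
    ∃ R, ∀ a, f a ≠ 0 → a.coord R ≠ .infty := by
  obtain ⟨R, hR⟩ := IsCompact.elim_directed_cover hf
    (fun n => {a : Arrow Q H | a.coord n ≠ .infty}) isOpen_coord_ne_infty
    (fun a _ => Set.mem_iUnion.mpr a.ne_infty)
    (directed_of_isDirected_le fun m n h a ha => Arrow.ne_infty_mono h ha)
  exact ⟨R, fun a ha => hR (subset_tsupport f ha)⟩

theorem hasCompactSupport_of_bound {f : Arrow Q H → ℂ} {R : ℕ}
    (h : ∀ a, f a ≠ 0 → a.coord R ≠ .infty) : HasCompactSupport f :=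
  .of_support_subset_isCompact (isCompact_coord_ne_infty R) fun a ha => h a ha

end Topology

/-! ### The convolution algebra and its regular representations -/

/-- The convolution `(f * g)(a) = ∑ f(b) g(b⁻¹ a)`, the sum running over all arrows `b` with the
same range as `a`. -/
def conv (f g : Arrow Q H → ℂ) (a : Arrow Q H) : ℂ :=
  ∑' b : {b : Arrow Q H // b.range = a.range}, f b * g (b.1.inverse.comp a)

/-- The involution `f^*(a) = conj (f(a⁻¹))`. -/
def involution (f : Arrow Q H → ℂ) (a : Arrow Q H) : ℂ := star (f a.inverse)

section conv

variable {f g : Arrow Q H → ℂ}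

theorem coord_inverse_ne_infty {a : Arrow Q H} {R : ℕ} (h : a.coord R ≠ .infty) :
    a.inverse.coord R ≠ .infty := by
  obtain ⟨x, γ, hγ, rfl⟩ := Arrow.exists_rep_of_ne_infty h
  rw [Arrow.inverse_arrow]
  exact arrow_ne_infty (inv_mem_words hγ)

theorem coord_comp_ne_infty {a b : Arrow Q H} {R S : ℕ} (hab : a.source = b.range)
    (h : a.coord R ≠ .infty) (h' : b.coord S ≠ .infty) : (a.comp b).coord (S + R) ≠ .infty := by
  obtain ⟨x, γ, hγ, rfl⟩ := Arrow.exists_rep_of_ne_infty h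
  obtain ⟨y, δ, hδ, rfl⟩ := Arrow.exists_rep_of_ne_infty h'
  rw [Arrow.source_arrow, Arrow.range_arrow] at hab
  subst hab
  rw [Arrow.comp_arrow]
  exact arrow_ne_infty (mul_mem_words hδ hγ)

theorem comp_inverse_comp {a b : Arrow Q H} (h : b.range = a.range) :
    b.comp (b.inverse.comp a) = a := by
  rw [← Arrow.comp_assoc (Arrow.range_inverse b).symm ((Arrow.source_inverse b).trans h),
    Arrow.comp_inverse, h, Arrow.unit_comp]

theorem conv_support {R S : ℕ} (hf : ∀ a, f a ≠ 0 → a.coord R ≠ .infty)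
    (hg : ∀ a, g a ≠ 0 → a.coord S ≠ .infty) (a : Arrow Q H) (h : conv f g a ≠ 0) :
    a.coord (S + R) ≠ .infty := by
  obtain ⟨⟨b, hb⟩, hne⟩ : ∃ b : {b : Arrow Q H // b.range = a.range},
      f b * g (b.1.inverse.comp a) ≠ 0 := by
    by_contra! h0
    exact h (by simp only [conv, h0, tsum_zero])
  have h1 := hf b (left_ne_zero_of_mul hne)
  have h2 := hg _ (right_ne_zero_of_mul hne)
  have h3 := coord_comp_ne_infty ?_ h1 h2
  · rwa [comp_inverse_comp hb] at h3
  · rw [Arrow.range_comp ((Arrow.source_inverse b).trans hb), Arrow.range_inverse]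

theorem conv_arrow {R : ℕ} (hf : ∀ a, f a ≠ 0 → a.coord R ≠ .infty) (x : UnitSpace Q H)
    (η : Γ) (T : Finset Γ)
    (hinj : Set.InjOn (fun γ => arrow x γ) T)
    (hsurj : ∀ γ ∈ words Q R, ∃ δ ∈ T, x.Same γ δ) :
    conv f g (arrow x η) = ∑ γ ∈ T, f (arrow x γ) * g (arrow (x.act γ) (η * γ⁻¹)) := by
  classical
  have hr : ∀ γ, (arrow x γ).range = (arrow x η).range := fun γ => by
    rw [Arrow.range_arrow, Arrow.range_arrow]
  let e : Γ → {b : Arrow Q H // b.range = (arrow x η).range} := fun γ => ⟨arrow x γ, hr γ⟩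
  have hc : ∀ γ, (arrow x γ).inverse.comp (arrow x η) = arrow (x.act γ) (η * γ⁻¹) := fun γ => by
    rw [Arrow.inverse_arrow]
    have h := Arrow.comp_arrow (x.act γ) γ⁻¹ η
    rwa [UnitSpace.act_act, inv_mul_cancel, UnitSpace.act_one] at h
  rw [conv, tsum_eq_sum (s := T.image e)]
  · rw [Finset.sum_image]
    · exact Finset.sum_congr rfl fun γ _ => by rw [← hc]
    · intro γ hγ δ hδ h
      exact hinj hγ hδ (congrArg Subtype.val h)
  · rintro ⟨b, hb⟩ hnot
    by_contra hne
    obtain ⟨y, γ, hγ, rfl⟩ := Arrow.exists_rep_of_ne_infty (hf b (left_ne_zero_of_mul hne))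
    have hb' := hb
    rw [Arrow.range_arrow, Arrow.range_arrow] at hb'
    subst hb'
    obtain ⟨δ, hδ, hs⟩ := hsurj γ hγ
    refine hnot (Finset.mem_image.mpr ⟨δ, hδ, Subtype.ext ?_⟩)
    exact arrow_eq_iff.mpr ⟨rfl, hs.symm⟩

theorem continuous_conv (hf : Continuous f) (hf' : HasCompactSupport f) (hg : Continuous g) :
    Continuous (conv f g) := by
  classical
  obtain ⟨R, hR⟩ := exists_support_bound hf'
  refine continuous_of_arrow fun η => continuous_iff_continuousAt.mpr fun x => ?_
  obtain ⟨T', hT', himg, hinj⟩ := (Set.surjOn_image (fun γ => arrow x γ)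
    (words Q R)).exists_subset_injOn_image_eq
  have hfin : T'.Finite := (words_finite Q R).subset hT'
  set T := hfin.toFinset with hTdef
  have hTmem : ∀ γ, γ ∈ T ↔ γ ∈ T' := fun γ => hfin.mem_toFinset
  have hsurj : ∀ γ ∈ words Q R, ∃ δ ∈ T, x.Same γ δ := by
    intro γ hγ
    have : arrow x γ ∈ (fun γ => arrow x γ) '' T' := by
      rw [hinj]; exact ⟨γ, hγ, rfl⟩
    obtain ⟨δ, hδ, e⟩ := this
    exact ⟨δ, (hTmem δ).mpr hδ, (arrow_eq_iff.mp e.symm).2⟩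
  have hev : ∀ᶠ y in nhds x, ∀ γ ∈ words Q R, ∀ δ ∈ words Q R, (y.Same γ δ ↔ x.Same γ δ) := by
    rw [Filter.eventually_all_finite (words_finite Q R)]
    intro γ _
    rw [Filter.eventually_all_finite (words_finite Q R)]
    exact fun δ _ => eventually_same_iff x γ δ
  have hcont : Continuous fun y : UnitSpace Q H =>
      ∑ γ ∈ T, f (arrow y γ) * g (arrow (y.act γ) (η * γ⁻¹)) :=
    continuous_finsetSum _ fun γ _ => (hf.comp (continuous_arrow γ)).mul
      (hg.comp ((continuous_arrow (η * γ⁻¹)).comp (continuous_act γ)))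
  refine hcont.continuousAt.congr ?_
  filter_upwards [hev] with y hy
  refine (conv_arrow hR y η T ?_ ?_).symm
  · intro γ hγ δ hδ e
    have hγ := (hTmem γ).mp hγ
    have hδ := (hTmem δ).mp hδ
    refine himg hγ hδ (arrow_eq_iff.mpr ⟨rfl, ?_⟩)
    exact (hy γ (hT' hγ) δ (hT' hδ)).mp (arrow_eq_iff.mp e).2
  · intro γ hγ
    obtain ⟨δ, hδ, hs⟩ := hsurj γ hγ
    exact ⟨δ, hδ, (hy γ hγ δ (hT' ((hTmem δ).mp hδ))).mpr hs⟩

theorem continuous_involution (hf : Continuous f) : Continuous (involution f) := by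
  refine continuous_of_arrow fun γ => ?_
  have : (fun x : UnitSpace Q H => involution f (arrow x γ)) =
      fun x => star (f (arrow (x.act γ) γ⁻¹)) := by
    funext x
    rw [involution, Arrow.inverse_arrow]
  rw [this]
  exact (hf.comp ((continuous_arrow γ⁻¹).comp (continuous_act γ))).star

theorem hasCompactSupport_conv (hf : HasCompactSupport f) (hg : HasCompactSupport g) :
    HasCompactSupport (conv f g) := by
  obtain ⟨R, hR⟩ := exists_support_bound hf
  obtain ⟨S, hS⟩ := exists_support_bound hg
  exact hasCompactSupport_of_bound (conv_support hR hS)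

theorem hasCompactSupport_involution (hf : HasCompactSupport f) :
    HasCompactSupport (involution f) := by
  obtain ⟨R, hR⟩ := exists_support_bound hf
  refine hasCompactSupport_of_bound (R := R) fun a ha => ?_
  have h := coord_inverse_ne_infty (hR a.inverse fun h0 => ha (by rw [involution, h0, star_zero]))
  rwa [Arrow.inverse_inverse] at h

end conv

/-- The arrows with source `x`. -/
abbrev SourceFibre (x : UnitSpace Q H) : Type _ := {a : Arrow Q H // a.source = x}

/-- The matrix of `π_x(f)`: its entries are `f(h g⁻¹)` for arrows `h` and `g` with source `x`. -/
def regMatrix (f : Arrow Q H → ℂ) (x : UnitSpace Q H) (h g : SourceFibre x) : ℂ :=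
  f (h.1.comp g.1.inverse)

theorem encard_range_eq_le (x : UnitSpace Q H) (R : ℕ) :
    {a : Arrow Q H | a.range = x ∧ a.coord R ≠ .infty}.encard ≤ (words Q R).ncard := by
  rw [(words_finite Q R).cast_ncard_eq]
  refine le_trans (Set.encard_le_encard ?_) (Set.encard_image_le (fun γ => arrow x γ) _)
  rintro a ⟨rfl, h⟩
  obtain ⟨y, γ, hγ, rfl⟩ := Arrow.exists_rep_of_ne_infty h
  exact ⟨γ, hγ, by rw [Arrow.range_arrow]⟩

theorem source_eq_range_inverse {x : UnitSpace Q H} (h g : SourceFibre x) :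
    h.1.source = g.1.inverse.range := by
  rw [Arrow.range_inverse, h.2, g.2]

theorem comp_inverse_comp_right {x : UnitSpace Q H} (h g : SourceFibre x) :
    (h.1.comp g.1.inverse).comp g.1 = h.1 := by
  rw [Arrow.comp_assoc (source_eq_range_inverse h g) (Arrow.source_inverse _),
    Arrow.inverse_comp, g.2.trans h.2.symm, Arrow.comp_unit]

theorem inverse_comp_inverse {x : UnitSpace Q H} (h g : SourceFibre x) :
    (h.1.comp g.1.inverse).inverse = g.1.comp h.1.inverse := by
  obtain ⟨h, rfl⟩ := h
  obtain ⟨g, hg⟩ := g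
  obtain ⟨y, γ, rfl⟩ := h.exists_rep
  obtain ⟨z, δ, rfl⟩ := g.exists_rep
  rw [Arrow.source_arrow, Arrow.source_arrow] at hg
  dsimp only
  have hz : z = (y.act γ).act δ⁻¹ := by
    rw [← hg, UnitSpace.act_act, inv_mul_cancel, UnitSpace.act_one]
  rw [Arrow.inverse_arrow, hg, Arrow.comp_arrow, Arrow.inverse_arrow, Arrow.inverse_arrow, ← hg,
    Arrow.comp_arrow, hz, UnitSpace.act_act, mul_inv_rev, inv_inv]

theorem regMatrix_isBanded {f : Arrow Q H → ℂ} {R : ℕ} {C : ℝ}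
    (hR : ∀ a, f a ≠ 0 → a.coord R ≠ .infty) (hC : ∀ a, ‖f a‖ ≤ C) (x : UnitSpace Q H) :
    IsBanded (regMatrix f x) C (words Q R).ncard := by
  refine ⟨fun h g => hC _, fun h => ?_, fun g => ?_⟩
  · refine le_trans ?_ (encard_range_eq_le h.1.range R)
    refine Set.encard_le_encard_of_injOn (f := fun g : SourceFibre x => h.1.comp g.1.inverse) ?_ ?_
    · intro g hg
      exact ⟨Arrow.range_comp (source_eq_range_inverse h g), hR _ hg⟩
    · intro g _ g' _ e
      have e : h.1.comp g.1.inverse = h.1.comp g'.1.inverse := e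
      have e2 := congrArg Arrow.inverse e
      rw [inverse_comp_inverse, inverse_comp_inverse] at e2
      apply Subtype.ext
      rw [← comp_inverse_comp_right g h, e2, comp_inverse_comp_right]
  · refine le_trans ?_ (encard_range_eq_le g.1.range R)
    refine Set.encard_le_encard_of_injOn (f := fun h : SourceFibre x => g.1.comp h.1.inverse) ?_ ?_
    · intro h hh
      refine ⟨Arrow.range_comp (source_eq_range_inverse g h), ?_⟩
      have h1 := coord_inverse_ne_infty (hR _ hh)
      rwa [inverse_comp_inverse] at h1
    · intro h _ h' _ e
      have e : g.1.comp h.1.inverse = g.1.comp h'.1.inverse := e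
      have e2 := congrArg Arrow.inverse e
      rw [inverse_comp_inverse, inverse_comp_inverse] at e2
      apply Subtype.ext
      rw [← comp_inverse_comp_right h g, e2, comp_inverse_comp_right]

theorem regMatrix_conv (f g : Arrow Q H → ℂ) (x : UnitSpace Q H) (h k : SourceFibre x) :
    regMatrix (conv f g) x h k = ∑' l, regMatrix f x h l * regMatrix g x l k := by
  have hr : ∀ l : SourceFibre x, (h.1.comp l.1.inverse).range = (h.1.comp k.1.inverse).range :=
    fun l => by
      rw [Arrow.range_comp (source_eq_range_inverse h l),
        Arrow.range_comp (source_eq_range_inverse h k)]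
  have hrange : (h.1.comp k.1.inverse).range = h.1.range :=
    Arrow.range_comp (source_eq_range_inverse h k)
  let e : SourceFibre x ≃ {b : Arrow Q H // b.range = (h.1.comp k.1.inverse).range} :=
    { toFun := fun l => ⟨h.1.comp l.1.inverse, hr l⟩
      invFun := fun b => ⟨b.1.inverse.comp h.1, by
        rw [Arrow.source_comp, h.2]
        rw [Arrow.source_inverse, b.2, hrange]⟩
      left_inv := fun l => by
        apply Subtype.ext
        dsimp only
        rw [inverse_comp_inverse, comp_inverse_comp_right]
      right_inv := fun b => by
        apply Subtype.ext
        dsimp only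
        have hb : b.1.inverse.source = h.1.range := by
          rw [Arrow.source_inverse, b.2, hrange]
        have h1 : (b.1.inverse.comp h.1).source = x := by rw [Arrow.source_comp hb, h.2]
        have h2 := inverse_comp_inverse ⟨b.1.inverse.comp h.1, h1⟩ h
        dsimp only at h2
        rw [← h2, Arrow.comp_assoc hb (Arrow.range_inverse _).symm, Arrow.comp_inverse, ← hb,
          Arrow.comp_unit, Arrow.inverse_inverse] }
  rw [regMatrix, conv, ← e.tsum_eq]
  refine tsum_congr fun l => ?_
  have : (h.1.comp l.1.inverse).inverse.comp (h.1.comp k.1.inverse) = l.1.comp k.1.inverse := by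
    rw [inverse_comp_inverse, ← Arrow.comp_assoc, comp_inverse_comp_right]
    · rw [Arrow.source_comp (source_eq_range_inverse l h), Arrow.source_inverse]
    · exact source_eq_range_inverse h k
  change f _ * g ((h.1.comp l.1.inverse).inverse.comp (h.1.comp k.1.inverse)) = _
  rw [this]
  rfl

theorem regMatrix_involution (f : Arrow Q H → ℂ) (x : UnitSpace Q H) (h g : SourceFibre x) :
    regMatrix (involution f) x h g = star (regMatrix f x g h) := by
  rw [regMatrix, involution, inverse_comp_inverse, regMatrix]

variable (Q H)

/-- The convolution algebra `C_c(𝒢)` of continuous functions with compact support on the groupoid,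
with pointwise linear structure, convolution as product and `f^*(a) = conj (f(a⁻¹))`
as involution. -/
def ConvAlg : Type _ := CompactlySupportedContinuousMap (Arrow Q H) ℂ

namespace ConvAlg

instance : AddCommGroup (ConvAlg Q H) :=
  inferInstanceAs (AddCommGroup (CompactlySupportedContinuousMap (Arrow Q H) ℂ))

instance : Module ℂ (ConvAlg Q H) :=
  inferInstanceAs (Module ℂ (CompactlySupportedContinuousMap (Arrow Q H) ℂ))

variable {Q H}

/-- The value of a function at an arrow. -/
def val (f : ConvAlg Q H) : Arrow Q H → ℂ :=
  (show CompactlySupportedContinuousMap (Arrow Q H) ℂ from f).toFun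

theorem continuous_val (f : ConvAlg Q H) : Continuous f.val :=
  (show CompactlySupportedContinuousMap (Arrow Q H) ℂ from f).continuous_toFun

theorem hasCompactSupport_val (f : ConvAlg Q H) : HasCompactSupport f.val :=
  (show CompactlySupportedContinuousMap (Arrow Q H) ℂ from f).hasCompactSupport'

/-- A continuous function with compact support as an element of the convolution algebra. -/
def mk (f : Arrow Q H → ℂ) (hf : Continuous f) (hf' : HasCompactSupport f) : ConvAlg Q H :=
  (⟨⟨f, hf⟩, hf'⟩ : CompactlySupportedContinuousMap (Arrow Q H) ℂ)

theorem ext {f g : ConvAlg Q H} (h : f.val = g.val) : f = g :=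
  CompactlySupportedContinuousMap.ext fun a => congrFun h a

instance : Mul (ConvAlg Q H) where
  mul f g := mk (conv f.val g.val)
    (continuous_conv f.continuous_val f.hasCompactSupport_val g.continuous_val)
    (hasCompactSupport_conv f.hasCompactSupport_val g.hasCompactSupport_val)

instance : Star (ConvAlg Q H) where
  star f := mk (involution f.val) (continuous_involution f.continuous_val)
    (hasCompactSupport_involution f.hasCompactSupport_val)

theorem exists_isBanded (f : ConvAlg Q H) : ∃ C N, ∀ x, IsBanded (regMatrix f.val x) C N := by
  obtain ⟨R, hR⟩ := exists_support_bound f.hasCompactSupport_val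
  obtain ⟨C, hC⟩ := f.continuous_val.bounded_above_of_compact_support f.hasCompactSupport_val
  exact ⟨C, _, fun x => regMatrix_isBanded hR hC x⟩

/-- The operator `π_x(f)` on `ℓ²(𝒢_x)`, which is given on basis vectors
by `π_x(f) δ_g = ∑ f(g') δ_{g' g}`, the sum running over the arrows `g'` whose source is the range
of `g`. Equivalently, `(π_x(f) ξ)(h) = ∑ f(h g⁻¹) ξ(g)`, the sum running over the arrows `g`
with source `x`. -/
def op (x : UnitSpace Q H) (f : ConvAlg Q H) : BL2 (SourceFibre x) :=
  matrixOp (regMatrix f.val x) (f.exists_isBanded.imp fun _ h => h.imp fun _ h => h x)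

theorem op_add (x : UnitSpace Q H) (f g : ConvAlg Q H) : op x (f + g) = op x f + op x g :=
  matrixOp_add _ _ _ fun _ _ => rfl

theorem op_smul (x : UnitSpace Q H) (c : ℂ) (f : ConvAlg Q H) : op x (c • f) = c • op x f :=
  matrixOp_smul c _ _ fun _ _ => rfl

theorem op_mul (x : UnitSpace Q H) (f g : ConvAlg Q H) : op x (f * g) = op x f * op x g :=
  matrixOp_mul _ _ _ fun h k => regMatrix_conv f.val g.val x h k

theorem op_star (x : UnitSpace Q H) (f : ConvAlg Q H) : op x (star f) = star (op x f) :=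
  matrixOp_star _ _ fun h k => regMatrix_involution f.val x h k

theorem op_zero (x : UnitSpace Q H) : op x (0 : ConvAlg Q H) = 0 := by
  simpa using op_smul x 0 (0 : ConvAlg Q H)

theorem op_injective {f g : ConvAlg Q H} (h : ∀ x, op x f = op x g) : f = g := by
  refine ext (funext fun a => ?_)
  have h1 := congrFun (congrFun (matrixOp_injective _ _ (h a.source)) ⟨a, rfl⟩)
    ⟨Arrow.unit a.source, Arrow.source_unit _⟩
  have h2 : a.comp (Arrow.unit a.source).inverse = a := by
    rw [Arrow.unit, Arrow.inverse_arrow, inv_one, UnitSpace.act_one]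
    exact Arrow.comp_unit a
  simpa only [regMatrix, h2] using h1

instance : NonUnitalRing (ConvAlg Q H) where
  left_distrib f g h := op_injective fun x => by simp only [op_add, op_mul, mul_add]
  right_distrib f g h := op_injective fun x => by simp only [op_add, op_mul, add_mul]
  zero_mul f := op_injective fun x => by simp only [op_zero, op_mul, zero_mul]
  mul_zero f := op_injective fun x => by simp only [op_zero, op_mul, mul_zero]
  mul_assoc f g h := op_injective fun x => by simp only [op_mul, mul_assoc]

instance : StarRing (ConvAlg Q H) where
  star_involutive f := op_injective fun x => by simp only [op_star, star_star]
  star_mul f g := op_injective fun x => by simp only [op_star, op_mul, star_mul]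
  star_add f g := op_injective fun x => by simp only [op_star, op_add, star_add]

instance : StarModule ℂ (ConvAlg Q H) where
  star_smul c f := op_injective fun x => by simp only [op_star, op_smul, star_smul]

instance : IsScalarTower ℂ (ConvAlg Q H) (ConvAlg Q H) where
  smul_assoc c f g := op_injective fun x => by
    simp only [smul_eq_mul, op_mul, op_smul, smul_mul_assoc]

instance : SMulCommClass ℂ (ConvAlg Q H) (ConvAlg Q H) where
  smul_comm c f g := op_injective fun x => by
    simp only [smul_eq_mul, op_mul, op_smul, mul_smul_comm]

variable (Q H)

/-- The C*-algebra of all bounded families of operators `T x` on `ℓ²(𝒢_x)`, for `x` in the unit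
space, with the norm `sup_x ‖T x‖`. -/
def FibreOps : Type _ := lp (fun x : UnitSpace Q H => BL2 (SourceFibre x)) ⊤

instance : NonUnitalCStarAlgebra (FibreOps Q H) :=
  inferInstanceAs (NonUnitalCStarAlgebra (lp (fun x : UnitSpace Q H => BL2 (SourceFibre x)) ⊤))

variable {Q H}

theorem memlp_op (f : ConvAlg Q H) : Memℓp (fun x => op x f) ⊤ := by
  obtain ⟨C, N, h⟩ := f.exists_isBanded
  refine memℓp_infty ⟨|C| * N, ?_⟩
  rintro _ ⟨x, rfl⟩
  exact norm_matrixOp_le _ (h x)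

variable (Q H)

/-- The family of all regular representations `π_x` of `C_c(𝒢)`, so that
`‖regularReps Q H f‖ = sup_x ‖π_x(f)‖` is the reduced norm of `f`. -/
def regularReps : ConvAlg Q H →⋆ₙₐ[ℂ] FibreOps Q H where
  toFun f := ⟨fun x => op x f, f.memlp_op⟩
  map_smul' c f := lp.ext (funext fun x => op_smul x c f)
  map_zero' := lp.ext (funext fun x => op_zero x)
  map_add' f g := lp.ext (funext fun x => op_add x f g)
  map_mul' f g := lp.ext (funext fun x => op_mul x f g)
  map_star' f := lp.ext (funext fun x => op_star x f)

/-- The reduced groupoid C*-algebra: the completion of `C_c(𝒢)` in the reduced norm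
`‖f‖ = sup_x ‖π_x(f)‖`, realised as the norm closure of the image of `C_c(𝒢)` under the family
of all regular representations. -/
def reducedCStar : NonUnitalStarSubalgebra ℂ (FibreOps Q H) :=
  (NonUnitalStarAlgHom.range (regularReps Q H)).topologicalClosure

instance : NonUnitalCStarAlgebra (reducedCStar Q H) :=
  NonUnitalStarSubalgebra.nonUnitalCStarAlgebra _
    (h_closed := NonUnitalStarSubalgebra.isClosed_topologicalClosure _)

variable {Q H}

/-- The canonical map from `C_c(𝒢)` to its completion. -/
def toReduced (f : ConvAlg Q H) : reducedCStar Q H :=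
  ⟨regularReps Q H f, NonUnitalStarSubalgebra.le_topologicalClosure _ ⟨f, rfl⟩⟩

/-- The norm of the reduced groupoid C*-algebra restricts to the reduced norm on `C_c(𝒢)`. -/
theorem norm_toReduced (f : ConvAlg Q H) : ‖toReduced f‖ = ⨆ x, ‖op x f‖ :=
  lp.norm_eq_ciSup (regularReps Q H f)

end ConvAlg

end Combinatorics

/-! ### Uniformly recurrent subgroups -/

section URS

variable {Γ : Type*} [Group Γ]

open Classical in
/-- The topology of pointwise convergence of characteristic functions on the space of subgroups. -/
@[reducible] def subgroupTopology (Γ : Type*) [Group Γ] : TopologicalSpace (Subgroup Γ) :=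
  TopologicalSpace.induced (fun (H : Subgroup Γ) (γ : Γ) => decide (γ ∈ H)) Pi.topologicalSpace

/-- The orbit of a subgroup under conjugation. -/
def conjOrbit (H : Subgroup Γ) : Set (Subgroup Γ) :=
  {K | ∃ γ : Γ, K = H.map (MulAut.conj γ).toMonoidHom}

/-- `Z` is a uniformly recurrent subgroup: a non-empty closed conjugation-invariant set of subgroups
in which every orbit is dense. -/
structure IsURS (Z : Set (Subgroup Γ)) : Prop where
  nonempty : Z.Nonempty
  isClosed : @IsClosed _ (subgroupTopology Γ) Z
  invariant : ∀ H ∈ Z, conjOrbit H ⊆ Z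
  minimal : ∀ H ∈ Z, Z ⊆ @closure _ (subgroupTopology Γ) (conjOrbit H)

end URS

end

end ElekURS

open ElekURS

/-!
A local kernel `K` of width `N` is the same thing as a function on the points of level `N` that
vanishes at `∞`, so it defines a locally constant function `f_K` with compact support on the arrows,
with `f_K (x, γ) = K(p, γ p)` for every vertex `p` whose ball of large radius represents `x`
(`KernelAlg.fn_arrow`). This formula turns products and adjoints of kernels into convolutions and
involutions (`KernelAlg.toConvAlg`). By compactness, every locally constant function in `C_c(𝒢)`
factors through some level and so arises in this way, and every function in `C_c(𝒢)` is a uniform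
limit of such functions with supports in a fixed compact set, which makes them dense for the reduced
norm (`exists_fn_rel`, `mem_range_toConvAlg_iff`, `exists_norm_regularReps_sub_le`).

For the norms, the isotropy group of a unit `x` is a limit of stabilizers of vertices, hence an
element of the uniformly recurrent subgroup `Z`. Its conjugation orbit is dense in `Z`, so every ball
of the Schreier graph of `H` occurs along the orbit of `x` (`IsURS.exists_act_coord_eq`). Conversely,
finite pieces of the orbit of `x` occur in the Schreier graph by the definition of the unit space.
Therefore the matrices of `K` and of `π_x(f_K)` have the same finite submatrices, and since the norm
of a matrix is determined by its finite submatrices (`norm_matrixOp_le_of_embedding`), the two norms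
agree. By density all the norms `‖π_x(f)‖` agree for `f` in `C_c(𝒢)`, and `K ↦ f_K` is an isometry
with dense range between algebras with the given completions, so it extends to an isomorphism.
-/

namespace ElekURS

noncomputable section

/-! ### Comparing norms of banded matrices -/

section NormComparison

variable {X X' : Type*}

theorem orthonormal_basisVec : Orthonormal ℂ (basisVec : X → L2 X) := by
  classical
  rw [orthonormal_iff_ite]
  intro x y
  rw [inner_basisVec]
  split_ifs with h
  · rw [h, basisVec_self]
  · exact basisVec_ne h

/-- Relabelling the basis along `φ` preserves the norms of the vectors supported on `S`. -/
theorem norm_sq_sum_smul_basisVec {S : Finset X} {φ : X → X'} (hφ : Set.InjOn φ S) (c : X → ℂ) :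
    ‖∑ b ∈ S, c b • basisVec (φ b)‖ ^ 2 = ∑ b ∈ S, ‖c b‖ ^ 2 := by
  have ho : Orthonormal ℂ fun b : S => basisVec (φ b) :=
    orthonormal_basisVec.comp _ (Set.injOn_iff_injective.mp hφ)
  have h := ho.inner_sum (fun b => c b) (fun b => c b) Finset.univ
  rw [inner_self_eq_norm_sq_to_K, Finset.sum_coe_sort S fun b => c b • basisVec (φ b),
    Finset.sum_coe_sort S fun b => (starRingEnd ℂ) (c b) * c b] at h
  simp only [RCLike.conj_mul] at h
  exact_mod_cast h

theorem sum_norm_sq_le (η : L2 X) (s : Finset X) : ∑ x ∈ s, ‖η x‖ ^ 2 ≤ ‖η‖ ^ 2 := by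
  have := lp.sum_rpow_le_norm_rpow (p := 2) (by norm_num) η s
  simpa using this

theorem matrixOp_sum_smul_basisVec {M : X' → X' → ℂ} (h : ∃ C N, IsBanded M C N) (S : Finset X)
    (φ : X → X') (c : X → ℂ) (x : X') :
    matrixOp M h (∑ b ∈ S, c b • basisVec (φ b)) x = ∑ b ∈ S, c b * M x (φ b) := by
  rw [map_sum, lp.coeFn_sum, Finset.sum_apply]
  refine Finset.sum_congr rfl fun b _ => ?_
  rw [map_smul, lp.coeFn_smul, Pi.smul_apply, matrixOp_basisVec, smul_eq_mul]

/-- If every finite submatrix of `M` occurs as a submatrix of `M'`, then the norm of `M` is at most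
the norm of `M'`: both norms can be computed on finitely supported vectors. -/
theorem norm_matrixOp_le_of_embedding {M : X → X → ℂ} {M' : X' → X' → ℂ}
    (h : ∃ C N, IsBanded M C N) (h' : ∃ C N, IsBanded M' C N)
    (emb : ∀ S : Finset X, ∃ φ : X → X', Set.InjOn φ S ∧
      ∀ a ∈ S, ∀ b ∈ S, M a b = M' (φ a) (φ b)) :
    ‖matrixOp M h‖ ≤ ‖matrixOp M' h'‖ := by
  classical
  have key : ∀ (S : Finset X) (c : X → ℂ), ‖matrixOp M h (∑ b ∈ S, c b • basisVec b)‖ ≤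
      ‖matrixOp M' h'‖ * ‖∑ b ∈ S, c b • basisVec b‖ := by
    intro S c
    refine lp.norm_le_of_forall_sum_le (by norm_num) (by positivity) fun s => ?_
    -- `φ` has to respect the support `S` of the vector and the coordinates `s` of its image
    obtain ⟨φ, hφ, hM⟩ := emb (s ∪ S)
    have hs : Set.InjOn φ s := hφ.mono (by simp)
    have hS : Set.InjOn φ S := hφ.mono (by simp)
    have e1 : ∀ x ∈ s, matrixOp M h (∑ b ∈ S, c b • basisVec b) x =
        matrixOp M' h' (∑ b ∈ S, c b • basisVec (φ b)) (φ x) := by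
      intro x hx
      refine (matrixOp_sum_smul_basisVec h S id c x).trans
        (Eq.trans ?_ (matrixOp_sum_smul_basisVec h' S φ c (φ x)).symm)
      refine Finset.sum_congr rfl fun b hb => ?_
      rw [id, hM x (Finset.mem_union_left _ hx) b (Finset.mem_union_right _ hb)]
    have e2 : ‖∑ b ∈ S, c b • basisVec (φ b)‖ = ‖∑ b ∈ S, c b • basisVec b‖ := by
      rw [← sq_eq_sq₀ (norm_nonneg _) (norm_nonneg _), norm_sq_sum_smul_basisVec hS]
      exact (norm_sq_sum_smul_basisVec (φ := id) (Set.injOn_id _) c).symm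
    simp only [ENNReal.toReal_ofNat, Real.rpow_ofNat]
    calc ∑ x ∈ s, ‖matrixOp M h (∑ b ∈ S, c b • basisVec b) x‖ ^ 2
        = ∑ x ∈ s, ‖matrixOp M' h' (∑ b ∈ S, c b • basisVec (φ b)) (φ x)‖ ^ 2 :=
          Finset.sum_congr rfl fun x hx => by rw [e1 x hx]
      _ = ∑ y ∈ s.image φ, ‖matrixOp M' h' (∑ b ∈ S, c b • basisVec (φ b)) y‖ ^ 2 :=
          (Finset.sum_image (f := fun y =>
            ‖matrixOp M' h' (∑ b ∈ S, c b • basisVec (φ b)) y‖ ^ 2) hs).symm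
      _ ≤ ‖matrixOp M' h' (∑ b ∈ S, c b • basisVec (φ b))‖ ^ 2 := sum_norm_sq_le _ _
      _ ≤ (‖matrixOp M' h'‖ * ‖∑ b ∈ S, c b • basisVec (φ b)‖) ^ 2 := by
          gcongr
          exact ContinuousLinearMap.le_opNorm _ _
      _ = _ := by rw [e2]
  refine ContinuousLinearMap.opNorm_le_bound _ (norm_nonneg _) fun ξ => ?_
  have hs : HasSum (fun y => ξ y • basisVec y) ξ := by
    convert lp.hasSum_single (p := 2) (by norm_num) ξ using 2 with y
    ext x
    by_cases hx : x = y
    · subst hx; simp [basisVec_self]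
    · simp [basisVec_ne hx, hx]
  exact le_of_tendsto_of_tendsto (((matrixOp M h).continuous.tendsto ξ).comp hs).norm
    (hs.norm.const_mul _) (Filter.Eventually.of_forall fun S => key S ξ)

end NormComparison

/-! ### Extending isometries to completions -/

section Extension

variable {E A B : Type*} [NonUnitalRing E] [StarRing E] [Module ℂ E]
  [NonUnitalCStarAlgebra A] [NonUnitalCStarAlgebra B]

/-- Two completions of the same `*`-algebra for the same norm are isomorphic. -/
theorem exists_starAlgEquiv_of_norm_eq (i : E →⋆ₙₐ[ℂ] A) (j : E →⋆ₙₐ[ℂ] B)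
    (hi : DenseRange i) (hj : DenseRange j) (hn : ∀ x, ‖j x‖ = ‖i x‖) :
    ∃ Φ : A ≃⋆ₐ[ℂ] B, Isometry Φ ∧ ∀ x, Φ (i x) = j x := by
  let i' : E →ₗ[ℂ] A := { toFun := i, map_add' := map_add i, map_smul' := map_smul i }
  let j' : E →ₗ[ℂ] B := { toFun := j, map_add' := map_add j, map_smul' := map_smul j }
  let Φ : A ≃ₗᵢ[ℂ] B := (LinearEquiv.refl ℂ E).extendOfIsometry i' j' hi hj hn
  have hΦ : ∀ x, Φ (i x) = j x :=
    (LinearEquiv.refl ℂ E).extendOfIsometry_eq i' j' hi hj hn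
  have hc : Continuous Φ := Φ.continuous
  have hmul : ∀ S T, Φ (S * T) = Φ S * Φ T := by
    intro S T
    refine hi.induction_on₂ (p := fun S T => Φ (S * T) = Φ S * Φ T) ?_ (fun x y => ?_) S T
    · exact isClosed_eq (by fun_prop) (by fun_prop)
    · rw [← map_mul, hΦ, hΦ, hΦ, map_mul]
  have hstar : ∀ T, Φ (star T) = star (Φ T) := by
    intro T
    refine hi.induction_on (p := fun T => Φ (star T) = star (Φ T)) T ?_ fun x => ?_
    · exact isClosed_eq (by fun_prop) (by fun_prop)
    · rw [← map_star, hΦ, hΦ, map_star]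
  exact ⟨{ Φ.toLinearEquiv with
    map_mul' := hmul
    map_star' := hstar
    map_smul' := fun c T => map_smul Φ c T }, Φ.isometry, hΦ⟩

end Extension

/-- `*`-homomorphisms between C*-algebras are continuous, hence determined by their values on a dense
set. -/
theorem eq_of_eq_on_denseRange {E A B : Type*} [NonUnitalCStarAlgebra A]
    [NonUnitalCStarAlgebra B] {i : E → A} (hi : DenseRange i) {Φ : A → B} (hΦ : Continuous Φ)
    (Ψ : A →⋆ₙₐ[ℂ] B) (h : ∀ x, Ψ (i x) = Φ (i x)) (T : A) : Ψ T = Φ T := by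
  have hΨ : Continuous Ψ := AddMonoidHomClass.continuous_of_bound Ψ 1 fun a => by
    rw [one_mul]
    exact NonUnitalStarAlgHom.norm_apply_le Ψ a
  exact congrFun (hi.equalizer hΨ hΦ (funext h)) T

variable {Γ : Type*} [Group Γ] {Q : SymmGen Γ} {H : Subgroup Γ}

/-! ### Minimality of the action on the unit space -/

section Minimality

theorem UnitSpace.same_act_iff {x : UnitSpace Q H} {γ η ε : Γ} :
    (x.act γ).Same η ε ↔ x.Same (η * γ) (ε * γ) := by
  refine ⟨fun h => h.mul_right, fun h => ?_⟩
  rw [← UnitSpace.act_one x, ← inv_mul_cancel γ, ← UnitSpace.act_act] at h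
  have := h.mul_right
  rwa [mul_inv_cancel_right, mul_inv_cancel_right] at this

theorem UnitSpace.same_one_act_iff {x : UnitSpace Q H} {γ η : Γ} :
    (x.act γ).Same η 1 ↔ x.Same (γ⁻¹ * η * γ) 1 := by
  rw [same_act_iff, one_mul]
  refine ⟨fun h => ?_, fun h => ?_⟩
  · have := h.mul_left γ⁻¹
    rwa [inv_mul_cancel, ← mul_assoc] at this
  · have := h.mul_left γ
    rwa [mul_one, mul_assoc, mul_inv_cancel_left] at this

/-- The isotropy group of a unit: the elements of `Γ` that describe closed paths at `x`. -/
def UnitSpace.isotropy (x : UnitSpace Q H) : Subgroup Γ where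
  carrier := {γ | x.Same γ 1}
  one_mem' := UnitSpace.Same.refl x 1
  mul_mem' {γ δ} hγ hδ := by
    have := UnitSpace.Same.mul_left hδ γ
    rw [mul_one] at this
    exact this.trans hγ
  inv_mem' {γ} hγ := by
    have := UnitSpace.Same.mul_left hγ γ⁻¹
    rw [mul_one, inv_mul_cancel] at this
    exact this.symm

theorem UnitSpace.mem_isotropy {x : UnitSpace Q H} {γ : Γ} : γ ∈ x.isotropy ↔ x.Same γ 1 := Iff.rfl

theorem UnitSpace.mem_isotropy_iff_smul_eq {x : UnitSpace Q H} {γ : Γ} {m : ℕ} {p : Γ ⧸ H}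
    (hγ : γ ∈ words Q m) (hp : x.coord m = ballClass Q m p) : γ ∈ x.isotropy ↔ γ • p = p := by
  refine ⟨fun h => ?_, fun h => ⟨m, p, hγ, one_mem_words m, hp, by rwa [one_smul]⟩⟩
  have := UnitSpace.Same.smul_eq h hγ (one_mem_words m) hp
  rwa [one_smul] at this

theorem UnitSpace.isotropy_act (x : UnitSpace Q H) (γ : Γ) :
    (x.act γ).isotropy = x.isotropy.map (MulAut.conj γ).toMonoidHom := by
  ext η
  rw [Subgroup.mem_map_equiv, MulAut.conj_symm_apply, mem_isotropy, mem_isotropy, same_one_act_iff]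

open Classical in
theorem continuous_decide_mem (γ : Γ) :
    @Continuous _ _ (subgroupTopology Γ) _ fun K : Subgroup Γ => decide (γ ∈ K) := by
  let _ := subgroupTopology Γ
  have h : Continuous fun (K : Subgroup Γ) (γ : Γ) => decide (γ ∈ K) := continuous_induced_dom
  exact (continuous_apply γ).comp h

theorem isOpen_setOf_mem_iff (L : Subgroup Γ) (γ : Γ) :
    @IsOpen _ (subgroupTopology Γ) {K : Subgroup Γ | γ ∈ K ↔ γ ∈ L} := by
  classical
  let _ := subgroupTopology Γ
  have := (isOpen_discrete {decide (γ ∈ L)}).preimage (continuous_decide_mem γ)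
  convert this using 1
  ext K
  simp

variable {Z : Set (Subgroup Γ)}

theorem IsURS.stabilizer_mem (hZ : IsURS Z) (hH : H ∈ Z) (p : Γ ⧸ H) :
    MulAction.stabilizer Γ p ∈ Z := by
  obtain ⟨γ, rfl⟩ := QuotientGroup.mk_surjective p
  refine hZ.invariant H hH ⟨γ, ?_⟩
  have : (γ : Γ ⧸ H) = γ • ((1 : Γ) : Γ ⧸ H) := by
    rw [MulAction.Quotient.smul_coe, smul_eq_mul, mul_one]
  rw [this, MulAction.stabilizer_smul_eq_stabilizer_map_conj, MulAction.stabilizer_quotient]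

/-- The isotropy group of a unit is a limit of stabilizers of vertices. -/
theorem IsURS.isotropy_mem (hZ : IsURS Z) (hH : H ∈ Z) (x : UnitSpace Q H) : x.isotropy ∈ Z := by
  classical
  let _ := subgroupTopology Γ
  refine hZ.isClosed.mem_of_tendsto (f := fun n => MulAction.stabilizer Γ (x.rep n))
    (b := Filter.atTop) ?_ (Filter.Eventually.of_forall fun n => hZ.stabilizer_mem hH _)
  rw [nhds_induced, Filter.tendsto_comap_iff, tendsto_pi_nhds]
  intro γ
  refine tendsto_const_nhds.congr' ?_
  filter_upwards [Filter.eventually_ge_atTop (wordLength Q γ)] with n hn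
  have := UnitSpace.mem_isotropy_iff_smul_eq (mem_words_of_wordLength_le hn) (x.coord_rep n)
  simp [this]

/-- Every ball of the Schreier graph occurs along the orbit of every unit, because the isotropy group
of the unit belongs to `Z` and so has a dense conjugation orbit there. -/
theorem IsURS.exists_act_coord_eq (hZ : IsURS Z) (hH : H ∈ Z) (x : UnitSpace Q H) (n : ℕ)
    (p : Γ ⧸ H) : ∃ γ, (x.act γ).coord n = ballClass Q n p := by
  let _ := subgroupTopology Γ
  have hcl := hZ.minimal _ (hZ.isotropy_mem hH x) (hZ.stabilizer_mem hH p)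
  have hopen : IsOpen (⋂ η ∈ words Q (n + 1 + (n + 1)),
      {K : Subgroup Γ | η ∈ K ↔ η ∈ MulAction.stabilizer Γ p}) :=
    (words_finite Q _).isOpen_biInter fun η _ => isOpen_setOf_mem_iff _ η
  obtain ⟨K, hK, γ, rfl⟩ := mem_closure_iff.mp hcl _ hopen (by simp)
  rw [← UnitSpace.isotropy_act] at hK
  refine ⟨γ, ?_⟩
  have hq := (x.act γ).coord_rep (n + 1 + (n + 1))
  -- `δ q = ε q` is a statement about `ε⁻¹ δ`, a word of twice the length
  rw [UnitSpace.coord_mono (by omega) hq, ballClass_eq]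
  refine BallEquiv.of_smul_eq_iff fun δ hδ ε hε => ?_
  have hw : ε⁻¹ * δ ∈ words Q (n + 1 + (n + 1)) := mul_mem_words (inv_mem_words hε) hδ
  have h1 := Set.mem_iInter₂.mp hK _ hw
  rw [Set.mem_ofPred_eq, UnitSpace.mem_isotropy_iff_smul_eq hw hq, MulAction.mem_stabilizer_iff,
    mul_smul, mul_smul, inv_smul_eq_iff, inv_smul_eq_iff] at h1
  exact h1

end Minimality

/-! ### Local kernels as functions on the groupoid -/

/-- The unit given by a vertex of the Schreier graph. -/
def UnitSpace.ofVertex (p : Γ ⧸ H) : UnitSpace Q H := ⟨fun n => ballClass Q n p, fun _ => rfl⟩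

/-- The function on level `N` induced by a kernel: its value at the class of `(x, y)` is `K x y`, and
its value at `∞` is `0`. The value is computed at a chosen representative, so it is meaningful only
if `K` is a local kernel of width `N`. -/
def levelFun (N : ℕ) (K : Γ ⧸ H → Γ ⧸ H → ℂ) (c : BallPoint Q H N) : ℂ :=
  Option.elim c 0 fun p => K p.out.1.1 p.out.1.2

theorem levelFun_infty (N : ℕ) (K : Γ ⧸ H → Γ ⧸ H → ℂ) :
    levelFun N K (.infty : BallPoint Q H N) = 0 := rfl

theorem levelFun_ballPoint {N : ℕ} {K : Γ ⧸ H → Γ ⧸ H → ℂ} (hK : IsLocalKernel Q N K)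
    (x y : Γ ⧸ H) : levelFun N K (ballPoint Q N x y) = K x y := by
  by_cases h : y ∈ ball Q N x
  · rw [ballPoint_of_mem h]
    obtain ⟨θ, hθ, e⟩ := Quotient.mk_out (s := ballPointSetoid Q H N) ⟨(x, y), h⟩
    have := hK.iso_eq le_rfl hθ (Quotient.out (s := ballPointSetoid Q H N)
      (Quotient.mk _ ⟨(x, y), h⟩)).2
    rw [e] at this
    exact this
  · rw [ballPoint_of_notMem h, levelFun_infty, hK.width x y h]

/-- A width of a local kernel. -/
def KernelAlg.width (K : KernelAlg Q H) : ℕ := K.exists_isLocalKernel.choose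

theorem KernelAlg.isLocalKernel_width (K : KernelAlg Q H) : IsLocalKernel Q K.width K.val :=
  K.exists_isLocalKernel.choose_spec

/-- The function `f_K` on the arrows of the groupoid given by a local kernel `K`, computed on the level
of a chosen width of `K`; every other width gives the same function (`KernelAlg.fn_eq_levelFun`). -/
def KernelAlg.fn (K : KernelAlg Q H) (a : Arrow Q H) : ℂ := levelFun K.width K.val (a.coord K.width)

namespace KernelAlg

/-- The function `f_K` can be computed on every level that is a width of `K`. -/
theorem fn_eq_levelFun {K : KernelAlg Q H} {N : ℕ} (hN : IsLocalKernel Q N K.val) (a : Arrow Q H) :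
    K.fn a = levelFun N K.val (a.coord N) := by
  have hW := K.isLocalKernel_width
  by_cases h : a.coord (max K.width N) = .infty
  · have h1 : a.coord K.width = .infty := by
      by_contra h'
      exact Arrow.ne_infty_mono (le_max_left _ _) h' h
    have h2 : a.coord N = .infty := by
      by_contra h'
      exact Arrow.ne_infty_mono (le_max_right _ _) h' h
    rw [fn, h1, h2, levelFun_infty, levelFun_infty]
  · obtain ⟨p, q, -, e⟩ := exists_ballPoint h
    rw [fn, Arrow.coord_mono (le_max_left _ _) e, Arrow.coord_mono (le_max_right _ _) e,
      levelFun_ballPoint hW, levelFun_ballPoint hN]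

theorem fn_arrow {K : KernelAlg Q H} {N : ℕ} (hN : IsLocalKernel Q N K.val) {m : ℕ} (hm : N ≤ m)
    {x : UnitSpace Q H} {γ : Γ} (hγ : γ ∈ words Q m) {p : Γ ⧸ H}
    (hp : x.coord m = ballClass Q m p) : K.fn (arrow x γ) = K.val p (γ • p) := by
  rw [fn_eq_levelFun (hN.mono hm), arrow_coord le_rfl hγ hp, levelFun_ballPoint (hN.mono hm)]

theorem isLocallyConstant_comp_coord {Y : Type*} (N : ℕ) (g : BallPoint Q H N → Y) :
    IsLocallyConstant fun a : Arrow Q H => g (a.coord N) :=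
  (IsLocallyConstant.of_discrete g).comp_continuous
    ((continuous_apply N).comp continuous_induced_dom)

theorem isLocallyConstant_fn (K : KernelAlg Q H) : IsLocallyConstant K.fn :=
  isLocallyConstant_comp_coord K.width (levelFun K.width K.val)

theorem coord_ne_infty_of_fn_ne_zero {K : KernelAlg Q H} {a : Arrow Q H} (h : K.fn a ≠ 0) :
    a.coord K.width ≠ .infty := by
  intro h'
  rw [fn, h', levelFun_infty] at h
  exact h rfl

theorem fn_add (K L : KernelAlg Q H) (a : Arrow Q H) : (K + L).fn a = K.fn a + L.fn a := by
  obtain ⟨x, γ, rfl⟩ := a.exists_rep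
  obtain ⟨k, hk⟩ := exists_mem_words Q γ
  set m := K.width + L.width + (K + L).width + k
  have hγ : γ ∈ words Q m := words_mono (by omega) hk
  have hp := x.coord_rep m
  rw [fn_arrow (K + L).isLocalKernel_width (by omega) hγ hp,
    fn_arrow K.isLocalKernel_width (by omega) hγ hp, fn_arrow L.isLocalKernel_width (by omega) hγ hp]
  rfl

theorem fn_smul (c : ℂ) (K : KernelAlg Q H) (a : Arrow Q H) : (c • K).fn a = c * K.fn a := by
  obtain ⟨x, γ, rfl⟩ := a.exists_rep
  obtain ⟨k, hk⟩ := exists_mem_words Q γ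
  set m := K.width + (c • K).width + k
  have hγ : γ ∈ words Q m := words_mono (by omega) hk
  have hp := x.coord_rep m
  rw [fn_arrow (c • K).isLocalKernel_width (by omega) hγ hp,
    fn_arrow K.isLocalKernel_width (by omega) hγ hp]
  rfl

theorem fn_star (K : KernelAlg Q H) (a : Arrow Q H) : (star K).fn a = involution K.fn a := by
  obtain ⟨x, γ, rfl⟩ := a.exists_rep
  obtain ⟨k, hk⟩ := exists_mem_words Q γ
  set m := K.width + (star K).width + k
  have hγ : γ ∈ words Q m := words_mono (by omega) hk
  have hp := x.coord_rep (m + m)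
  rw [fn_arrow (star K).isLocalKernel_width (by omega) (words_mono (by omega) hγ) hp, involution,
    Arrow.inverse_arrow, fn_arrow K.isLocalKernel_width (m := m) (by omega) (inv_mem_words hγ)
      (UnitSpace.act_coord hγ le_rfl hp), inv_smul_smul]
  rfl

theorem fn_mul (K L : KernelAlg Q H) (a : Arrow Q H) : (K * L).fn a = conv K.fn L.fn a := by
  classical
  obtain ⟨x, η, rfl⟩ := a.exists_rep
  obtain ⟨k, hk⟩ := exists_mem_words Q η
  set R := K.width with hR
  set m := R + L.width + (K * L).width + k
  -- level `m` at the translates `γ x` is determined by level `m + m` at `x`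
  have hx := x.coord_rep (m + m)
  set p := x.rep (m + m)
  have hRm : ∀ γ ∈ words Q R, γ ∈ words Q (m + m) := fun γ hγ => words_mono (by omega) hγ
  -- `T` contains exactly one `γ` for every vertex `γ p` of the `R`-ball around `p`
  obtain ⟨T', hT', hinj, himg⟩ := (Set.surjOn_image (fun γ => γ • p)
    (words Q R)).exists_subset_injOn_image_eq
  have hfin : T'.Finite := (words_finite Q R).subset hT'
  have hTmem : ∀ γ, γ ∈ hfin.toFinset ↔ γ ∈ T' := fun γ => hfin.mem_toFinset
  rw [conv_arrow (fun a => coord_ne_infty_of_fn_ne_zero) x η hfin.toFinset,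
    fn_arrow (K * L).isLocalKernel_width (by omega) (words_mono (by omega) hk) hx]
  · change ∑' z, K.val p z * L.val z (η • p) = _
    rw [K.isLocalKernel_width.tsum_eq le_rfl]
    have hball : (ball_finite (Q := Q) K.width p).toFinset =
        hfin.toFinset.image fun γ => γ • p := by
      ext y
      rw [Set.Finite.mem_toFinset, ← Finset.mem_coe, Finset.coe_image, Set.Finite.coe_toFinset,
        himg]
      rfl
    rw [hball, Finset.sum_image (by rwa [Set.Finite.coe_toFinset])]
    refine Finset.sum_congr rfl fun γ hγ => ?_
    have hγ := hT' ((hTmem γ).mp hγ)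
    have hact : (x.act γ).coord m = ballClass Q m (γ • p) :=
      UnitSpace.act_coord (words_mono (by omega) hγ) le_rfl hx
    have hw : η * γ⁻¹ ∈ words Q m := words_mono (by omega) (mul_mem_words hk (inv_mem_words hγ))
    rw [fn_arrow K.isLocalKernel_width (by omega) (hRm γ hγ) hx,
      fn_arrow L.isLocalKernel_width (by omega) hw hact, mul_smul, inv_smul_smul]
  · intro γ hγ δ hδ e
    have hγ := (hTmem γ).mp hγ
    have hδ := (hTmem δ).mp hδ
    exact hinj hγ hδ ((arrow_eq_iff.mp e).2.smul_eq (hRm γ (hT' hγ)) (hRm δ (hT' hδ)) hx)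
  · intro γ hγ
    have : γ • p ∈ (fun γ => γ • p) '' T' := by rw [himg]; exact ⟨γ, hγ, rfl⟩
    obtain ⟨δ, hδ, e⟩ := this
    exact ⟨δ, (hTmem δ).mpr hδ, _, _, hRm γ hγ, hRm δ (hT' hδ), hx, e.symm⟩

variable (Q H)

/-- The homomorphism `K ↦ f_K` from the local kernel algebra to the convolution algebra. -/
def toConvAlg : KernelAlg Q H →⋆ₙₐ[ℂ] ConvAlg Q H where
  toFun K := ConvAlg.mk K.fn K.isLocallyConstant_fn.continuous
    (hasCompactSupport_of_bound fun _ => coord_ne_infty_of_fn_ne_zero)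
  map_smul' c K := ConvAlg.ext (funext fun a => fn_smul c K a)
  map_zero' := ConvAlg.ext (funext fun a => by
    have := fn_smul 0 (0 : KernelAlg Q H) a
    rw [zero_smul, zero_mul] at this
    exact this)
  map_add' K L := ConvAlg.ext (funext fun a => fn_add K L a)
  map_mul' K L := ConvAlg.ext (funext fun a => fn_mul K L a)
  map_star' K := ConvAlg.ext (funext fun a => fn_star K a)

variable {Q H}

theorem val_toConvAlg (K : KernelAlg Q H) : (toConvAlg Q H K).val = K.fn := rfl

theorem toConvAlg_injective : Function.Injective (toConvAlg Q H) := by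
  intro K L h
  refine ext (funext fun p => funext fun q => ?_)
  obtain ⟨δ, rfl⟩ := MulAction.exists_smul_eq Γ p q
  obtain ⟨k, hk⟩ := exists_mem_words Q δ
  have hδ : δ ∈ words Q (K.width + L.width + k) := words_mono (by omega) hk
  have hp : (UnitSpace.ofVertex p : UnitSpace Q H).coord (K.width + L.width + k) =
    ballClass Q _ p := rfl
  rw [← fn_arrow K.isLocalKernel_width (by omega) hδ hp,
    ← fn_arrow L.isLocalKernel_width (by omega) hδ hp, ← val_toConvAlg, h, val_toConvAlg]

end KernelAlg

/-! ### Locally constant functions -/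

section Approximation

open Topology

theorem Arrow.coord_eq_of_le {a b : Arrow Q H} {m n : ℕ} (h : n ≤ m) (hm : a.coord m = b.coord m) :
    a.coord n = b.coord n := by
  induction m, h using Nat.le_induction with
  | base => exact hm
  | succ m _ ih => exact ih (by rw [← a.compat m, ← b.compat m, hm])

theorem exists_coord_eq_subset {a : Arrow Q H} {U : Set (Arrow Q H)} (hU : U ∈ 𝓝 a) :
    ∃ N, ∀ b : Arrow Q H, b.coord N = a.coord N → b ∈ U := by
  rw [nhds_induced, nhds_pi] at hU
  obtain ⟨V, hV, hVU⟩ := Filter.mem_comap.mp hU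
  obtain ⟨I, hI, t, ht, hIt⟩ := Filter.mem_pi.mp hV
  obtain ⟨N, hN⟩ := hI.bddAbove
  refine ⟨N, fun b hb => hVU (hIt fun i hi => ?_)⟩
  rw [Arrow.coord_eq_of_le (hN hi) hb]
  exact mem_of_mem_nhds (ht i)

/-- A relation between arrows that holds between any two sufficiently close arrows holds between any two
arrows of a compact open set that agree on a sufficiently high level. -/
theorem exists_level {r : Arrow Q H → Arrow Q H → Prop}
    (hr : ∀ a, ∃ U ∈ 𝓝 a, ∀ b ∈ U, ∀ b' ∈ U, r b b') (R : ℕ) :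
    ∃ N, R ≤ N ∧ ∀ b b', b.coord N = b'.coord N → b.coord R ≠ .infty → r b b' := by
  choose U hU hr using hr
  choose n hn using fun a => exists_coord_eq_subset (hU a)
  obtain ⟨t, -, ht⟩ := (isCompact_coord_ne_infty (Q := Q) (H := H) R).elim_nhds_subcover
    (fun a => {b | b.coord (n a) = a.coord (n a)})
    fun a _ => (isOpen_coord_eq_arrow (n a) _).mem_nhds rfl
  refine ⟨max R (t.sup n), le_max_left _ _, fun b b' h hb => ?_⟩
  obtain ⟨a, ha, hba⟩ := Set.mem_iUnion₂.mp (ht hb)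
  have hle : n a ≤ max R (t.sup n) := (Finset.le_sup ha).trans (le_max_right _ _)
  exact hr a b (hn a b hba) b' (hn a b' ((Arrow.coord_eq_of_le hle h).symm.trans hba))

/-- If `f` vanishes at all arrows whose component of level `N` is `∞`, then evaluating it at one arrow
for every point of level `N` gives the function of a local kernel of width `N`. -/
theorem exists_fn_eq_of_level {f : Arrow Q H → ℂ} {N : ℕ}
    (hN : ∀ a, f a ≠ 0 → a.coord N ≠ .infty) :
    ∃ K : KernelAlg Q H, ∀ a, ∃ a' : Arrow Q H, a'.coord N = a.coord N ∧ K.fn a = f a' := by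
  classical
  set g : BallPoint Q H N → ℂ := fun c =>
    if h : ∃ a : Arrow Q H, a.coord N = c then f h.choose else 0 with hg
  have hga : ∀ a : Arrow Q H, ∃ a' : Arrow Q H, a'.coord N = a.coord N ∧ g (a.coord N) = f a' := by
    intro a
    have h : ∃ a' : Arrow Q H, a'.coord N = a.coord N := ⟨a, rfl⟩
    exact ⟨h.choose, h.choose_spec, dif_pos h⟩
  have hinf : g .infty = 0 := by
    by_cases h : ∃ a : Arrow Q H, a.coord N = .infty
    · rw [hg]
      dsimp only
      rw [dif_pos h]
      by_contra h'
      exact hN _ h' h.choose_spec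
    · exact dif_neg h
  have hK : IsLocalKernel Q N fun p q : Γ ⧸ H => g (ballPoint Q N p q) := by
    refine ⟨fun p q h => ?_, ?_⟩
    · rw [ballPoint_of_notMem h, hinf]
    · rintro p q ⟨θ, hθ⟩ γ hγ
      rw [ballPoint_eq_of_iso hθ le_rfl (smul_mem_ball hγ p), hθ.map_smul hγ]
  let K : KernelAlg Q H := ⟨_, N, hK⟩
  refine ⟨K, fun a => ?_⟩
  obtain ⟨a', h1, h2⟩ := hga a
  refine ⟨a', h1, h2 ▸ ?_⟩
  rw [KernelAlg.fn_eq_levelFun (K := K) hK]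
  by_cases h : a.coord N = .infty
  · rw [h, levelFun_infty, hinf]
  · obtain ⟨p, q, -, e⟩ := exists_ballPoint h
    rw [e, levelFun_ballPoint (K := K.val) hK]
    rfl

/-- The function of a local kernel approximates `f` in the sense of `r`, without leaving the compact open
set that supports `f`. It is used with equality, where `f` is locally constant, and with closeness,
where `f` is continuous. -/
theorem exists_fn_rel {f : Arrow Q H → ℂ} {R : ℕ} (hR : ∀ a, f a ≠ 0 → a.coord R ≠ .infty)
    {r : ℂ → ℂ → Prop} (hrefl : ∀ z, r z z)
    (hr : ∀ a, ∃ U ∈ 𝓝 a, ∀ b ∈ U, ∀ b' ∈ U, r (f b) (f b')) :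
    ∃ K : KernelAlg Q H, (∀ a, r (K.fn a) (f a)) ∧ ∀ a, K.fn a ≠ 0 → a.coord R ≠ .infty := by
  obtain ⟨N, hRN, hN⟩ := exists_level hr R
  obtain ⟨K, hK⟩ := exists_fn_eq_of_level fun a ha => Arrow.ne_infty_mono hRN (hR a ha)
  refine ⟨K, fun a => ?_, fun a ha => ?_⟩
  · obtain ⟨a', h1, h2⟩ := hK a
    rw [h2]
    by_cases h : a'.coord R = .infty
    · have h' : a.coord R = .infty := (Arrow.coord_eq_of_le hRN h1).symm.trans h
      have e1 : f a' = 0 := by_contra fun h0 => hR _ h0 h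
      have e2 : f a = 0 := by_contra fun h0 => hR _ h0 h'
      rw [e1, e2]
      exact hrefl 0
    · exact hN a' a h1 h
  · obtain ⟨a', h1, h2⟩ := hK a
    rw [← Arrow.coord_eq_of_le hRN h1]
    exact hR a' (h2 ▸ ha)

theorem mem_range_toConvAlg_iff {f : ConvAlg Q H} :
    f ∈ Set.range (KernelAlg.toConvAlg Q H) ↔ IsLocallyConstant f.val := by
  constructor
  · rintro ⟨K, rfl⟩
    exact K.isLocallyConstant_fn
  · intro hf
    obtain ⟨R, hR⟩ := exists_support_bound f.hasCompactSupport_val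
    obtain ⟨K, hK, -⟩ := exists_fn_rel (r := Eq) hR (fun _ => rfl) fun a =>
      ⟨_, (hf.isOpen_fiber (f.val a)).mem_nhds rfl, fun b hb b' hb' => hb.trans (Eq.symm hb')⟩
    exact ⟨K, ConvAlg.ext (funext hK)⟩

/-- The locally constant functions are dense in `C_c(𝒢)` for the reduced norm: a function in `C_c(𝒢)` is
a uniform limit of locally constant functions with supports in a fixed compact open set. -/
theorem exists_norm_regularReps_sub_le (f : ConvAlg Q H) {ε : ℝ} (hε : 0 < ε) :
    ∃ K : KernelAlg Q H,
      ‖ConvAlg.regularReps Q H (KernelAlg.toConvAlg Q H K - f)‖ ≤ ε := by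
  obtain ⟨R, hR⟩ := exists_support_bound f.hasCompactSupport_val
  obtain ⟨c, hc⟩ : ∃ c : ℝ, c = (words Q R).ncard := ⟨_, rfl⟩
  have hc0 : 0 ≤ c := hc ▸ Nat.cast_nonneg _
  set δ : ℝ := ε / (c + 1) with hδ
  have hδ0 : 0 < δ := by positivity
  obtain ⟨K, hK, hKR⟩ := exists_fn_rel (r := fun z w => ‖z - w‖ ≤ δ) hR (fun z => by simp [hδ0.le])
    fun a => ⟨f.val ⁻¹' Metric.ball (f.val a) (δ / 2),
      f.continuous_val.continuousAt (Metric.ball_mem_nhds _ (by positivity)), fun b hb b' hb' => by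
        have h1 := Metric.mem_ball.mp hb
        have h2 := Metric.mem_ball'.mp hb'
        have h3 := dist_triangle (f.val b) (f.val a) (f.val b')
        rw [← dist_eq_norm]
        linarith⟩
  refine ⟨K, ?_⟩
  refine lp.norm_le_of_forall_le hε.le fun x => ?_
  have hval : ∀ a, (KernelAlg.toConvAlg Q H K - f).val a = K.fn a - f.val a := fun _ => rfl
  have hsupp : ∀ a, (KernelAlg.toConvAlg Q H K - f).val a ≠ 0 → a.coord R ≠ .infty := by
    intro a ha
    rw [hval] at ha
    by_cases h : K.fn a = 0
    · exact hR a fun h' => ha (by rw [h, h', sub_zero])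
    · exact hKR a h
  have hb := regMatrix_isBanded hsupp (C := δ) (fun a => by rw [hval]; exact hK a) x
  refine (norm_matrixOp_le ⟨_, _, hb⟩ hb).trans ?_
  rw [abs_of_pos hδ0, ← hc, hδ, div_mul_eq_mul_div, div_le_iff₀ (by positivity)]
  nlinarith

end Approximation

/-! ### The norms of the regular representations -/

section Norms

/-- The arrow from `x` to `γ x`, the inverse of the arrow represented by `(x, γ)`. -/
def arrowFrom (x : UnitSpace Q H) (γ : Γ) : SourceFibre x :=
  ⟨(arrow x γ).inverse, by rw [Arrow.source_inverse, Arrow.range_arrow]⟩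

theorem exists_arrowFrom_eq {x : UnitSpace Q H} (h : SourceFibre x) : ∃ γ, arrowFrom x γ = h := by
  obtain ⟨h, rfl⟩ := h
  refine ⟨h.inverse.label, Subtype.ext ?_⟩
  have := h.inverse.eq_arrow
  rw [Arrow.range_inverse] at this
  change (arrow _ _).inverse = h
  rw [← this, Arrow.inverse_inverse]

theorem arrowFrom_eq_iff {x : UnitSpace Q H} {γ δ : Γ} :
    arrowFrom x γ = arrowFrom x δ ↔ x.Same γ δ := by
  rw [arrowFrom, arrowFrom, Subtype.mk.injEq]
  constructor
  · intro h
    have := congrArg Arrow.inverse h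
    rw [Arrow.inverse_inverse, Arrow.inverse_inverse] at this
    exact (arrow_eq_iff.mp this).2
  · intro h
    rw [arrow_eq_iff.mpr ⟨rfl, h⟩]

theorem regMatrix_arrowFrom (f : Arrow Q H → ℂ) (x : UnitSpace Q H) (γ δ : Γ) :
    regMatrix f x (arrowFrom x γ) (arrowFrom x δ) = f (arrow (x.act γ) (δ * γ⁻¹)) := by
  change f ((arrow x γ).inverse.comp (arrow x δ).inverse.inverse) = _
  rw [Arrow.inverse_inverse, Arrow.inverse_arrow]
  have := Arrow.comp_arrow (x.act γ) γ⁻¹ δ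
  rw [UnitSpace.act_act, inv_mul_cancel, UnitSpace.act_one] at this
  rw [this]

/-- The entry of `π_x(f_K)` at `arrowFrom x γ` and `arrowFrom x δ` is an entry of `K` at vertices near a
vertex `p` representing `x`. The level leaves room for the width of `K`, for the word `δ γ⁻¹`, and
for the passage from `x` to `γ x`. -/
theorem KernelAlg.fn_arrow_act (K : KernelAlg Q H) {x : UnitSpace Q H} {γ δ : Γ} {k : ℕ}
    (hγ : γ ∈ words Q k) (hδ : δ ∈ words Q k) {p : Γ ⧸ H}
    (hp : x.coord (K.width + (k + k) + k) = ballClass Q _ p) :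
    K.fn (arrow (x.act γ) (δ * γ⁻¹)) = K.val (γ • p) (δ • p) := by
  rw [fn_arrow K.isLocalKernel_width (m := K.width + (k + k)) (by omega)
    (words_mono (by omega) (mul_mem_words hδ (inv_mem_words hγ)))
    (UnitSpace.act_coord hγ le_rfl hp), mul_smul, inv_smul_smul]

theorem exists_forall_mem_words {X : Type*} (S : Finset X) (δ : X → Γ) :
    ∃ k, ∀ a ∈ S, δ a ∈ words Q k :=
  ⟨S.sup fun a => wordLength Q (δ a), fun _ ha =>
    mem_words_of_wordLength_le (Finset.le_sup (f := fun a => wordLength Q (δ a)) ha)⟩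

/-- Finite pieces of the orbit of a unit look like finite pieces of the Schreier graph. -/
theorem norm_op_toConvAlg_le (K : KernelAlg Q H) (x : UnitSpace Q H) :
    ‖ConvAlg.op x (KernelAlg.toConvAlg Q H K)‖ ≤ ‖K.op‖ := by
  refine norm_matrixOp_le_of_embedding _ _ fun S => ?_
  choose δ hδ using fun h : SourceFibre x => exists_arrowFrom_eq h
  obtain ⟨k, hk⟩ := exists_forall_mem_words (Q := Q) S δ
  have hp := x.coord_rep (K.width + (k + k) + k)
  refine ⟨fun h => δ h • x.rep (K.width + (k + k) + k), fun a ha b hb e => ?_, fun a ha b hb => ?_⟩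
  · rw [← hδ a, ← hδ b, arrowFrom_eq_iff]
    exact ⟨_, _, words_mono (by omega) (hk a ha), words_mono (by omega) (hk b hb), hp, e⟩
  · rw [← K.fn_arrow_act (hk a ha) (hk b hb) hp, ← regMatrix_arrowFrom K.fn, hδ, hδ]
    rfl

/-- Finite pieces of the Schreier graph look like finite pieces of the orbit of any unit. -/
theorem IsURS.norm_op_le {Z : Set (Subgroup Γ)} (hZ : IsURS Z) (hH : H ∈ Z) (K : KernelAlg Q H)
    (x : UnitSpace Q H) : ‖K.op‖ ≤ ‖ConvAlg.op x (KernelAlg.toConvAlg Q H K)‖ := by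
  refine norm_matrixOp_le_of_embedding _ _ fun S => ?_
  choose δ hδ using fun a : Γ ⧸ H => MulAction.exists_smul_eq Γ ((1 : Γ) : Γ ⧸ H) a
  obtain ⟨k, hk⟩ := exists_forall_mem_words (Q := Q) S δ
  obtain ⟨γ, hγ⟩ := hZ.exists_act_coord_eq hH x (K.width + (k + k) + k) ((1 : Γ) : Γ ⧸ H)
  refine ⟨fun a => arrowFrom x (δ a * γ), fun a ha b hb e => ?_, fun a ha b hb => ?_⟩
  · have h := UnitSpace.same_act_iff.mpr (arrowFrom_eq_iff.mp e)
    rw [← hδ a, ← hδ b]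
    exact h.smul_eq (words_mono (by omega) (hk a ha)) (words_mono (by omega) (hk b hb)) hγ
  · rw [regMatrix_arrowFrom, ← UnitSpace.act_act, mul_inv_rev, mul_assoc, mul_inv_cancel_left,
      KernelAlg.val_toConvAlg, K.fn_arrow_act (hk a ha) (hk b hb) hγ, hδ, hδ]

variable {Z : Set (Subgroup Γ)}

theorem IsURS.norm_op_toConvAlg (hZ : IsURS Z) (hH : H ∈ Z) (K : KernelAlg Q H)
    (x : UnitSpace Q H) : ‖ConvAlg.op x (KernelAlg.toConvAlg Q H K)‖ = ‖K.op‖ :=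
  le_antisymm (norm_op_toConvAlg_le K x) (hZ.norm_op_le hH K x)

theorem ConvAlg.norm_op_le_norm_regularReps (x : UnitSpace Q H) (f : ConvAlg Q H) :
    ‖ConvAlg.op x f‖ ≤ ‖ConvAlg.regularReps Q H f‖ :=
  lp.norm_apply_le_norm ENNReal.top_ne_zero (ConvAlg.regularReps Q H f) x

theorem IsURS.norm_op_eq (hZ : IsURS Z) (hH : H ∈ Z) (f : ConvAlg Q H) (x y : UnitSpace Q H) :
    ‖ConvAlg.op x f‖ = ‖ConvAlg.op y f‖ := by
  suffices h : ∀ x y : UnitSpace Q H, ‖ConvAlg.op x f‖ ≤ ‖ConvAlg.op y f‖ from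
    le_antisymm (h x y) (h y x)
  intro x y
  refine le_of_forall_pos_le_add fun ε hε => ?_
  obtain ⟨K, hK⟩ := exists_norm_regularReps_sub_le f (half_pos hε)
  have hd : ∀ z : UnitSpace Q H,
      ‖ConvAlg.op z (KernelAlg.toConvAlg Q H K) - ConvAlg.op z f‖ ≤ ε / 2 := by
    intro z
    have := (ConvAlg.norm_op_le_norm_regularReps z _).trans hK
    rwa [eq_sub_of_add_eq ((ConvAlg.op_add z _ f).symm.trans
      (congrArg _ (sub_add_cancel _ f)))] at this
  have hx := norm_sub_norm_le (ConvAlg.op x f) (ConvAlg.op x (KernelAlg.toConvAlg Q H K))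
  have hy := norm_sub_norm_le (ConvAlg.op y (KernelAlg.toConvAlg Q H K)) (ConvAlg.op y f)
  rw [norm_sub_rev] at hx
  rw [hZ.norm_op_toConvAlg hH] at hx hy
  linarith [hd x, hd y]

theorem IsURS.norm_op_eq_norm_toReduced (hZ : IsURS Z) (hH : H ∈ Z) (f : ConvAlg Q H)
    (x : UnitSpace Q H) : ‖ConvAlg.op x f‖ = ‖ConvAlg.toReduced f‖ := by
  have : Nonempty (UnitSpace Q H) := ⟨x⟩
  rw [ConvAlg.norm_toReduced, ← ciSup_const (ι := UnitSpace Q H) (a := ‖ConvAlg.op x f‖)]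
  exact iSup_congr fun y => hZ.norm_op_eq hH f x y

end Norms

/-! ### The isomorphism of the reduced C*-algebras -/

section Completion

variable (Q H) in
/-- The embedding of the local kernel algebra into its completion, as a homomorphism. -/
def KernelAlg.toReducedHom : KernelAlg Q H →⋆ₙₐ[ℂ] KernelAlg.reducedCStar Q H :=
  NonUnitalStarAlgHom.codRestrict (KernelAlg.regularRep Q H) _ fun K =>
    (KernelAlg.toReduced K).2

variable (Q H) in
/-- The embedding of the convolution algebra into its completion, as a homomorphism. -/
def ConvAlg.toReducedHom : ConvAlg Q H →⋆ₙₐ[ℂ] ConvAlg.reducedCStar Q H :=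
  NonUnitalStarAlgHom.codRestrict (ConvAlg.regularReps Q H) _ fun f => (ConvAlg.toReduced f).2

theorem KernelAlg.denseRange_toReduced :
    DenseRange (KernelAlg.toReduced : KernelAlg Q H → KernelAlg.reducedCStar Q H) := by
  intro T
  rw [Topology.IsInducing.subtypeVal.closure_eq_preimage_closure_image, ← Set.range_comp]
  exact T.2

theorem ConvAlg.denseRange_toReduced :
    DenseRange (ConvAlg.toReduced : ConvAlg Q H → ConvAlg.reducedCStar Q H) := by
  intro T
  rw [Topology.IsInducing.subtypeVal.closure_eq_preimage_closure_image, ← Set.range_comp]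
  exact T.2

theorem denseRange_toReduced_toConvAlg :
    DenseRange fun K : KernelAlg Q H => ConvAlg.toReduced (KernelAlg.toConvAlg Q H K) := by
  refine dense_closure.mp (ConvAlg.denseRange_toReduced.mono ?_)
  rintro _ ⟨f, rfl⟩
  refine Metric.mem_closure_iff.mpr fun ε hε => ?_
  obtain ⟨K, hK⟩ := exists_norm_regularReps_sub_le f (half_pos hε)
  refine ⟨_, ⟨K, rfl⟩, ?_⟩
  rw [dist_comm, dist_eq_norm]
  have : ConvAlg.toReduced (KernelAlg.toConvAlg Q H K) - ConvAlg.toReduced f =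
      ConvAlg.toReduced (KernelAlg.toConvAlg Q H K - f) :=
    (map_sub (ConvAlg.toReducedHom Q H) _ _).symm
  rw [this]
  exact hK.trans_lt (half_lt_self hε)

end Completion

end

end ElekURS

theorem theorem3p3 {Γ : Type*} [Group Γ] (Q : SymmGen Γ) (Z : Set (Subgroup Γ)) (hZ : IsURS Z)
    (H : Subgroup Γ) (hH : H ∈ Z) :
    ∃ κ : KernelAlg Q H →⋆ₙₐ[ℂ] ConvAlg Q H,
      (∀ (K : KernelAlg Q H) (N : ℕ), IsLocalKernel Q N K.val → ∀ a : Arrow Q H,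
        (a.coord N = BallPoint.infty → (κ K).val a = 0) ∧
        ∀ (x y : Γ ⧸ H) (h : y ∈ ball Q N x),
          a.coord N = BallPoint.mk x y h → (κ K).val a = K.val x y) ∧
      Function.Injective κ ∧
      (∀ f : ConvAlg Q H, f ∈ Set.range κ ↔ IsLocallyConstant f.val) ∧
      (∀ (f : ConvAlg Q H) (x : UnitSpace Q H),
        ‖ConvAlg.op x f‖ = ‖ConvAlg.toReduced f‖) ∧
      (∀ (K : KernelAlg Q H) (x : UnitSpace Q H), ‖ConvAlg.op x (κ K)‖ = ‖K.op‖) ∧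
      ∃ Φ : KernelAlg.reducedCStar Q H ≃⋆ₐ[ℂ] ConvAlg.reducedCStar Q H,
        Isometry Φ ∧
        (∀ K : KernelAlg Q H, Φ (KernelAlg.toReduced K) = ConvAlg.toReduced (κ K)) ∧
        ∀ Ψ : KernelAlg.reducedCStar Q H →⋆ₙₐ[ℂ] ConvAlg.reducedCStar Q H,
          (∀ K : KernelAlg Q H, Ψ (KernelAlg.toReduced K) = ConvAlg.toReduced (κ K)) →
          ∀ T : KernelAlg.reducedCStar Q H, Ψ T = Φ T := by
  have hnorm : ∀ K : KernelAlg Q H, ‖ConvAlg.toReduced (KernelAlg.toConvAlg Q H K)‖ =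
      ‖KernelAlg.toReduced K‖ := fun K => by
    rw [← hZ.norm_op_eq_norm_toReduced hH _ (UnitSpace.ofVertex ((1 : Γ) : Γ ⧸ H)),
      hZ.norm_op_toConvAlg hH]
    rfl
  obtain ⟨Φ, hΦ, hΦK⟩ := exists_starAlgEquiv_of_norm_eq (KernelAlg.toReducedHom Q H)
    ((ConvAlg.toReducedHom Q H).comp (KernelAlg.toConvAlg Q H)) KernelAlg.denseRange_toReduced
    denseRange_toReduced_toConvAlg hnorm
  refine ⟨KernelAlg.toConvAlg Q H, fun K N hN a => ⟨fun h => ?_, fun x y hy h => ?_⟩,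
    KernelAlg.toConvAlg_injective, fun f => mem_range_toConvAlg_iff,
    hZ.norm_op_eq_norm_toReduced hH, hZ.norm_op_toConvAlg hH, Φ, hΦ, hΦK, fun Ψ hΨ T => ?_⟩
  · rw [KernelAlg.val_toConvAlg, KernelAlg.fn_eq_levelFun hN, h, levelFun_infty]
  · rw [KernelAlg.val_toConvAlg, KernelAlg.fn_eq_levelFun hN, h, ← ballPoint_of_mem hy,
      levelFun_ballPoint hN]
  · exact eq_of_eq_on_denseRange KernelAlg.denseRange_toReduced
      hΦ.continuous Ψ (fun K => (hΨ K).trans (hΦK K).symm) T
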